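/- Let $d\ge 1$ and let $F_d$ be the free group on $d$ generators, with word length $|\cdot|$ with respect to its free generators. Give the set $\mathrm{Sub}(F_d)$ of subgroups of $F_d$ the Chabauty topology, i.e. the subspace topology from $\mathrm{Sub}(F_d)\subset\{0,1\}^{F_d}$. A subgroup $\Delta\le F_d$ is called a boomerang subgroup if for every $g\in F_d$ there is a sequence of natural numbers $n_k\to\infty$ with $\lim_{k\to\infty} g^{n_k}\Delta g^{-n_k}=\Delta$. It is called confined if there is no sequence $(g_n)$ in $F_d$ with $\lim_{n\to\infty} g_n\Delta g_n^{-1}=\{1\}$. The critical exponent of $\Delta$ (acting on the Cayley tree of $F_d$) is $$\delta(\Delta)=\inf\Big\{s>0 \;\Big|\; \sum_{\gamma\in\Delta}e^{-s|\gamma|}<\infty\Big\}.$$ Then the set $$\{\delta(\Delta) \mid \Delta\le F_d \text{ is a boomerang subgroup that is not confined}\}$$ is a dense subset of the interval $[0,\ln(2d-1)]$. -/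

import Mathlib

open Filter Topology

noncomputable section

open Classical in
/-- The embedding `Sub(G) ⊆ {0,1}^G` sending a subgroup to its indicator function. -/
def subgroupIndicator (G : Type*) [Group G] (H : Subgroup G) : G → Bool :=
  fun g => decide (g ∈ H)

/-- The Chabauty topology on `Sub(G)` for a discrete group `G`: the subspace topology from the
product `{0,1}^G` of discrete two-point spaces. -/
instance chabautyTopology (G : Type*) [Group G] : TopologicalSpace (Subgroup G) :=
  TopologicalSpace.induced (subgroupIndicator G) inferInstance

/-- The conjugate subgroup `g H g⁻¹`. -/
def conjSubgroup {G : Type*} [Group G] (g : G) (H : Subgroup G) : Subgroup G :=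
  H.map (MulAut.conj g).toMonoidHom

/-- `H` is a boomerang subgroup: for every `g` there is a sequence of natural numbers `n k → ∞`
with `g ^ (n k) H g ^ (-n k) → H` in the Chabauty topology. -/
def IsBoomerang {G : Type*} [Group G] (H : Subgroup G) : Prop :=
  ∀ g : G, ∃ n : ℕ → ℕ, Tendsto n atTop atTop ∧
    Tendsto (fun k => conjSubgroup (g ^ n k) H) atTop (𝓝 H)

/-- `H` is confined: no sequence of conjugates of `H` converges to the trivial subgroup. -/
def IsConfined {G : Type*} [Group G] (H : Subgroup G) : Prop :=
  ¬ ∃ g : ℕ → G, Tendsto (fun k => conjSubgroup (g k) H) atTop (𝓝 (⊥ : Subgroup G))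

/-- The critical exponent of `H ≤ F_d` acting on the Cayley tree of `F_d` with respect to the
standard free generators. The base point is the vertex `1`, whose distance to the vertex `γ` is
the length `FreeGroup.norm γ` of the reduced word representing `γ`. -/
def criticalExponent {d : ℕ} (H : Subgroup (FreeGroup (Fin d))) : ℝ :=
  sInf {s : ℝ | 0 < s ∧
    Summable fun γ : H => Real.exp (-s * (FreeGroup.norm (γ : FreeGroup (Fin d)) : ℝ))}

end

/-! Write L = ln(2d-1). Since δ(Δ) ≤ L always holds and d = 1 is settled by the trivial subgroup,
density needs, for 0 < t₀ < t < L, a non-confined boomerang subgroup whose Poincaré series diverges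
at t₀ and converges at t. There are two independent constructions.

From finitely generated to boomerang (`exists_boomerang_of_fg`). A subgroup containing a power of
every element is a boomerang subgroup. Starting from a finitely generated H convergent at t,
enumerate the group and adjoin a high power of each element in turn. Finitely generated subgroups of
a free group are quasiconvex, so if no power of g lies in H, the axis of g overlaps H and its
translates by nontrivial elements of H only boundedly. Products alternating between H and a high
power of g then lose a bounded length per syllable, and a geometric series makes the growth of the
Poincaré series as small as desired (`exists_adjoin_pow`). No new element appears in a prescribed
ball, so conjugates that avoid large balls at a finite stage still do so in the union. Hence the
union is not confined, and its series still converges at t.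

Finitely generated subgroups with exponent in [t₀, t] (`exists_fg_poincare`). Suppose first that t₀
≥ L/2. In the Cayley graph of a finite quotient of large girth, take a maximal symmetric edge set
whose loop groups all converge at t₀. Convergence forces bounds, linear in the length and
independent of the graph, on the weight of paths of given length (`poincare_paths_le`). With large
girth, adding one more edge therefore keeps convergence at t (`poincare_union_edge_ne_top`), while
maximality makes it diverge at t₀. Smaller exponents come from the endomorphism raising every
generator to the k-th power, which divides exponents by k. -/

noncomputable section

open scoped ENNReal

/-! ### Common prefixes and Gromov products in the Cayley tree. -/

section CommonPrefix

variable {β : Type*} [DecidableEq β]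

/-- The length of the longest common prefix of two lists. -/
def commonPrefixLength : List β → List β → ℕ
  | a :: l, b :: m => if a = b then commonPrefixLength l m + 1 else 0
  | _, _ => 0

theorem le_commonPrefixLength_iff (l m : List β) (k : ℕ) :
    k ≤ commonPrefixLength l m ↔ k ≤ l.length ∧ k ≤ m.length ∧ l.take k = m.take k := by
  induction l generalizing m k with
  | nil => cases m <;> simp [commonPrefixLength]; rintro rfl; simp
  | cons a l ih =>
    cases m with
    | nil => simp [commonPrefixLength]; rintro rfl; simp
    | cons b m =>
      cases k with
      | zero => simp
      | succ k =>
        by_cases hab : a = b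
        · simp [commonPrefixLength, hab, ih]
        · simp [commonPrefixLength, hab]

theorem exists_split_commonPrefix (l m : List β) :
    ∃ p a b, l = p ++ a ∧ m = p ++ b ∧ p.length = commonPrefixLength l m ∧
      ∀ u ∈ a.head?, ∀ v ∈ b.head?, u ≠ v := by
  induction l generalizing m with
  | nil => exact ⟨[], [], m, by simp [commonPrefixLength]⟩
  | cons a l ih =>
    cases m with
    | nil => exact ⟨[], a :: l, [], by simp [commonPrefixLength]⟩
    | cons b m =>
      by_cases hab : a = b
      · obtain ⟨p, u, v, rfl, rfl, hp, h⟩ := ih m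
        exact ⟨a :: p, u, v, by simp, by simp [hab], by simp [commonPrefixLength, hab, hp], h⟩
      · exact ⟨[], a :: l, b :: m, rfl, rfl, by simp [commonPrefixLength, hab], by simpa using hab⟩

end CommonPrefix

namespace FreeGroup

variable {α : Type*} [DecidableEq α]

theorem IsReduced.invRev {L : List (α × Bool)} (h : IsReduced L) :
    IsReduced (FreeGroup.invRev L) := by
  rw [isReduced_iff_reduce_eq] at h ⊢
  rw [reduce_invRev, h]

theorem norm_mk_of_isReduced {L : List (α × Bool)} (h : IsReduced L) :
    norm (mk L) = L.length := by
  rw [norm, toWord_mk, h.reduce_eq]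

/-- The Gromov product of two elements of the free group based at `1` in the Cayley tree: the
length of the common prefix of their reduced words. -/
def gromov (x y : FreeGroup α) : ℕ := commonPrefixLength x.toWord y.toWord

/-- Once the common prefix is removed from both words, the remaining tails start with different
letters, so nothing further cancels in x⁻¹y. -/
theorem norm_inv_mul_add (x y : FreeGroup α) :
    norm (x⁻¹ * y) + 2 * gromov x y = norm x + norm y := by
  obtain ⟨p, a, b, hx, hy, hp, h⟩ := exists_split_commonPrefix x.toWord y.toWord
  have hxr : IsReduced (p ++ a) := hx ▸ isReduced_toWord
  have hyr : IsReduced (p ++ b) := hy ▸ isReduced_toWord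
  have ha : IsReduced a := hxr.infix ⟨p, [], by simp⟩
  have hb : IsReduced b := hyr.infix ⟨p, [], by simp⟩
  have hab : IsReduced (invRev a ++ b) := by
    unfold IsReduced
    rw [List.isChain_append]
    refine ⟨ha.invRev, hb, ?_⟩
    intro u hu v hv huv
    cases a with
    | nil => simp at hu
    | cons c a =>
      simp only [invRev, List.map_cons, List.reverse_cons, List.getLast?_concat,
        Option.mem_def, Option.some.injEq] at hu
      have := h c (by simp) v hv
      subst hu
      by_contra hne
      apply this
      ext
      · exact huv
      · simp only at hne
        simpa using hne
  have e : x⁻¹ * y = mk (invRev a ++ b) := by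
    rw [← mk_toWord (x := x), ← mk_toWord (x := y), hx, hy, ← mul_mk, ← mul_mk, ← mul_mk, ← inv_mk]
    group
  rw [e, norm_mk_of_isReduced hab, gromov, ← hp]
  have h1 : norm x = p.length + a.length := by rw [norm, hx, List.length_append]
  have h2 : norm y = p.length + b.length := by rw [norm, hy, List.length_append]
  rw [h1, h2, List.length_append, invRev_length]
  omega

theorem gromov_comm (x y : FreeGroup α) : gromov x y = gromov y x := by
  have h1 := norm_inv_mul_add x y
  have h2 := norm_inv_mul_add y x
  have h3 : norm (x⁻¹ * y) = norm (y⁻¹ * x) := by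
    rw [← norm_inv_eq]; congr 1; group
  omega

theorem gromov_le_left (x y : FreeGroup α) : gromov x y ≤ norm x :=
  ((le_commonPrefixLength_iff _ _ _).1 le_rfl).1

theorem gromov_le_right (x y : FreeGroup α) : gromov x y ≤ norm y :=
  ((le_commonPrefixLength_iff _ _ _).1 le_rfl).2.1

/-- The ultrametric inequality of a tree, on which all later overlap estimates rest. -/
theorem le_gromov_trans {x y z : FreeGroup α} {k : ℕ} (h1 : k ≤ gromov x y)
    (h2 : k ≤ gromov y z) : k ≤ gromov x z := by
  unfold gromov at *
  rw [le_commonPrefixLength_iff] at *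
  exact ⟨h1.1, h2.2.1, h1.2.2.trans h2.2.2⟩

theorem norm_mul_add (x y : FreeGroup α) :
    norm (x * y) + 2 * gromov x⁻¹ y = norm x + norm y := by
  simpa using norm_inv_mul_add x⁻¹ y

/-- The letters of x split into those cancelled by y and those surviving as a prefix of xy. -/
theorem gromov_mul_add (x y : FreeGroup α) : gromov x (x * y) + gromov x⁻¹ y = norm x := by
  have h1 := norm_mul_add x y
  have h2 := norm_inv_mul_add x (x * y)
  rw [inv_mul_cancel_left] at h2
  omega

@[simp] theorem gromov_one (x : FreeGroup α) : gromov x 1 = 0 := by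
  simpa using gromov_le_right x 1

/-- `p` lies on the geodesic from `1` to `x` in the Cayley tree. -/
def IsPrefix (p x : FreeGroup α) : Prop := norm p + norm (p⁻¹ * x) = norm x

theorem isPrefix_iff_gromov {p x : FreeGroup α} : IsPrefix p x ↔ norm p ≤ gromov p x := by
  have h1 := norm_inv_mul_add p x
  have h2 := gromov_le_left p x
  unfold IsPrefix
  omega

theorem isPrefix_mk_of_append {l m : List (α × Bool)} (h : IsReduced (l ++ m)) :
    IsPrefix (mk l) (mk (l ++ m)) := by
  have hl : IsReduced l := h.infix ⟨[], m, by simp⟩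
  have hm : IsReduced m := h.infix ⟨l, [], by simp⟩
  unfold IsPrefix
  rw [← mul_mk, inv_mul_cancel_left, mul_mk, norm_mk_of_isReduced h, norm_mk_of_isReduced hl,
    norm_mk_of_isReduced hm, List.length_append]

theorem exists_common_prefix {x y : FreeGroup α} {k : ℕ} (h : k ≤ gromov x y) :
    ∃ p, norm p = k ∧ IsPrefix p x ∧ IsPrefix p y := by
  obtain ⟨h1, h2, h3⟩ := (le_commonPrefixLength_iff _ _ _).1 h
  have hxr : IsReduced (x.toWord.take k ++ x.toWord.drop k) := by
    rw [List.take_append_drop]; exact isReduced_toWord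
  have hyr : IsReduced (y.toWord.take k ++ y.toWord.drop k) := by
    rw [List.take_append_drop]; exact isReduced_toWord
  refine ⟨mk (x.toWord.take k), ?_, ?_, ?_⟩
  · rw [norm_mk_of_isReduced (hxr.infix ⟨[], x.toWord.drop k, by simp⟩), List.length_take]
    omega
  · simpa [mk_toWord] using isPrefix_mk_of_append hxr
  · rw [h3]; simpa [mk_toWord] using isPrefix_mk_of_append hyr

/-- Triangles in a tree are tripods: the side from 1 to xy is covered by the sides from 1 to x and
from x to xy, and the latter is translated back by x⁻¹. -/
theorem isPrefix_mul_cases {x y p : FreeGroup α} (h : IsPrefix p (x * y)) :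
    IsPrefix p x ∨ IsPrefix (x⁻¹ * p) y := by
  by_cases hk : norm p ≤ gromov x (x * y)
  · left
    rw [isPrefix_iff_gromov] at *
    exact le_gromov_trans h (by rwa [gromov_comm])
  · right
    have hp := isPrefix_iff_gromov.1 h
    have e1 : gromov x p = gromov x (x * y) := by
      apply le_antisymm
      · by_contra hlt
        have a1 : gromov x (x * y) + 1 ≤ gromov x p := by omega
        have a2 : gromov x (x * y) + 1 ≤ gromov p (x * y) := by omega
        have := le_gromov_trans a1 a2
        omega
      · exact le_gromov_trans (y := x * y) le_rfl (by rw [gromov_comm (x * y) p]; omega)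
    have h1 := norm_inv_mul_add x p
    have h2 := norm_inv_mul_add x (x * y)
    rw [inv_mul_cancel_left] at h2
    unfold IsPrefix at *
    have e : (x⁻¹ * p)⁻¹ * y = p⁻¹ * (x * y) := by group
    rw [e]
    omega

/-- Write g as a conjugate of a cyclically reduced word: τ is the length of that word (the
translation length) and κ the length of the conjugator (the distance from 1 to the axis). -/
theorem exists_norm_pow {g : FreeGroup α} (hg : g ≠ 1) :
    ∃ τ κ : ℕ, 1 ≤ τ ∧ ∀ n : ℕ, n ≠ 0 → norm (g ^ n) = n * τ + 2 * κ := by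
  refine ⟨(reduceCyclically g.toWord).length, (reduceCyclically.conjugator g.toWord).length, ?_, ?_⟩
  · rw [Nat.one_le_iff_ne_zero]
    intro h
    have := reduceCyclically.conj_conjugator_reduceCyclically g.toWord
    rw [List.length_eq_zero_iff.1 h] at this
    apply hg
    rw [← mk_toWord (x := g), ← this, ← mul_mk, ← mul_mk, ← inv_mk, ← one_eq_mk]
    group
  · intro n hn
    rw [norm, toWord_pow, reduceCyclically.reduce_flatten_replicate isReduced_toWord, if_neg hn]
    simp
    ring


/-- By Nielsen–Schreier the subgroup generated by x and y is free; being abelian it has rank at most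
one. -/
theorem exists_pow_eq_zpow_of_commute {α : Type*} {x y : FreeGroup α} (h : Commute x y)
    (hx : x ≠ 1) (hy : y ≠ 1) : ∃ p q : ℤ, p ≠ 0 ∧ q ≠ 0 ∧ x ^ p = y ^ q := by
  let S := Subgroup.closure ({x, y} : Set (FreeGroup α))
  have hcomm : ∀ a b : S, a * b = b * a := by
    have hS : ∀ a ∈ ({x, y} : Set (FreeGroup α)), ∀ b ∈ ({x, y} : Set (FreeGroup α)),
        a * b = b * a := by
      rintro a (rfl | rfl) b (rfl | rfl)
      · rfl
      · exact h
      · exact h.symm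
      · rfl
    have := Subgroup.isMulCommutative_closure hS
    exact fun a b => this.is_comm.comm a b
  let e := IsFreeGroup.mulEquiv S
  have hsub : Subsingleton (IsFreeGroup.Generators S) := by
    classical
    refine ⟨fun a b => ?_⟩
    have h1 : of a * of b = of b * of a := by
      apply e.injective
      rw [_root_.map_mul, _root_.map_mul, hcomm]
    by_contra hab
    have h2 := congrArg toWord h1
    have red : ∀ a b : IsFreeGroup.Generators S, a ≠ b →
        (of a * of b).toWord = [(a, true), (b, true)] := by
      intro a b hab
      rw [toWord_mul, toWord_of, toWord_of]
      apply IsReduced.reduce_eq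
      simp [IsReduced]
    rw [red a b hab, red b a (Ne.symm hab)] at h2
    simp at h2
    exact hab h2.1
  have key : ∀ z w : FreeGroup (IsFreeGroup.Generators S), z ≠ 1 → w ≠ 1 →
      ∃ p q : ℤ, p ≠ 0 ∧ q ≠ 0 ∧ z ^ p = w ^ q := by
    intro z w hz hw
    rcases isEmpty_or_nonempty (IsFreeGroup.Generators S) with hE | ⟨⟨i⟩⟩
    · exact absurd (Subsingleton.elim z 1) hz
    · have hpow : ∀ z : FreeGroup (IsFreeGroup.Generators S), ∃ n : ℤ, z = of i ^ n := by
        intro z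
        induction z using FreeGroup.induction_on with
        | C1 => exact ⟨0, by simp⟩
        | of j => exact ⟨1, by rw [zpow_one, Subsingleton.elim j i]⟩
        | inv_of j _ => exact ⟨-1, by rw [zpow_neg, zpow_one, Subsingleton.elim j i]⟩
        | mul a b ha hb =>
          obtain ⟨n, rfl⟩ := ha
          obtain ⟨m, rfl⟩ := hb
          exact ⟨n + m, by rw [zpow_add]⟩
      obtain ⟨n, rfl⟩ := hpow z
      obtain ⟨m, rfl⟩ := hpow w
      refine ⟨m, n, ?_, ?_, ?_⟩
      · rintro rfl; simp at hw
      · rintro rfl; simp at hz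
      · rw [← zpow_mul, ← zpow_mul, mul_comm]
  have hxS : x ∈ S := Subgroup.subset_closure (by simp)
  have hyS : y ∈ S := Subgroup.subset_closure (by simp)
  obtain ⟨p, q, hp, hq, hpq⟩ := key (e.symm ⟨x, hxS⟩) (e.symm ⟨y, hyS⟩)
    (by rw [Ne, map_eq_one_iff _ e.symm.injective]; simpa [Subtype.ext_iff] using hx)
    (by rw [Ne, map_eq_one_iff _ e.symm.injective]; simpa [Subtype.ext_iff] using hy)
  refine ⟨p, q, hp, hq, ?_⟩
  rw [← map_zpow, ← map_zpow, e.symm.injective.eq_iff, Subtype.ext_iff] at hpq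
  simpa using hpq

/-! ### Quasiconvexity of finitely generated subgroups. -/

variable {α : Type*} [DecidableEq α]

theorem finite_setOf_norm_le [Finite α] (R : ℕ) : {x : FreeGroup α | norm x ≤ R}.Finite := by
  have := (List.finite_length_le (α × Bool) R).preimage
    (f := (toWord : FreeGroup α → _)) toWord_injective.injOn
  exact this

/-- Every vertex on a geodesic from `1` to a point of `H` is at distance at most `R` from a point
of `H`. -/
def IsQuasiconvex (H : Subgroup (FreeGroup α)) (R : ℕ) : Prop :=
  ∀ δ ∈ H, ∀ p, IsPrefix p δ → ∃ b, norm b ≤ R ∧ p * b⁻¹ ∈ H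

/-- The maximal length of a generator serves as constant. It survives products because a geodesic to
a product is covered by two translated geodesics, and inverses because a geodesic can be reversed.
-/
theorem exists_isQuasiconvex {H : Subgroup (FreeGroup α)} (hH : H.FG) :
    ∃ R, IsQuasiconvex H R := by
  obtain ⟨S, rfl⟩ := hH
  refine ⟨S.sup norm, fun δ hδ => ?_⟩
  induction hδ using Subgroup.closure_induction with
  | mem x hx =>
    intro p hp
    refine ⟨p, ?_, by simp⟩
    have : norm x ≤ S.sup norm := Finset.le_sup (f := norm) hx
    unfold IsPrefix at hp
    omega
  | one =>
    intro p hp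
    have : norm p = 0 := by
      unfold IsPrefix at hp
      rw [norm_one] at hp
      omega
    rw [norm_eq_zero] at this
    exact ⟨1, by simp, by simp [this]⟩
  | mul x y hx _ ihx ihy =>
    intro p hp
    rcases isPrefix_mul_cases hp with h | h
    · exact ihx p h
    · obtain ⟨b, hb, hb'⟩ := ihy _ h
      refine ⟨b, hb, ?_⟩
      have := mul_mem hx hb'
      simpa [mul_assoc] using this
  | inv x hx ih =>
    intro p hp
    have : IsPrefix (x * p) x := by
      unfold IsPrefix at *
      have e1 : (x * p)⁻¹ * x = p⁻¹ := by group
      have e2 : norm (p⁻¹ * x⁻¹) = norm (x * p) := by rw [← norm_inv_eq]; congr 1; group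
      rw [e1, norm_inv_eq]
      rw [e2, norm_inv_eq] at hp
      omega
    obtain ⟨b, hb, hb'⟩ := ih _ this
    refine ⟨b, hb, ?_⟩
    have := mul_mem (inv_mem hx) hb'
    simpa [mul_assoc] using this

/-! ### Overlap of a subgroup and its translates with the axis of an element. -/

section Powers

variable {g : FreeGroup α} {τ κ : ℕ}

/-- Both powers start with the conjugator and then run along the axis for i periods. -/
theorem norm_pow_sub_le_gromov (hg : ∀ n : ℕ, n ≠ 0 → norm (g ^ n) = n * τ + 2 * κ) {i N : ℕ}
    (hi : i ≠ 0) (hN : i ≤ N) : i * τ + κ ≤ gromov (g ^ i) (g ^ N) := by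
  obtain ⟨j, rfl⟩ := Nat.exists_eq_add_of_le hN
  have h1 := norm_inv_mul_add (g ^ i) (g ^ (i + j))
  rw [pow_add, inv_mul_cancel_left, ← pow_add, hg i hi, hg (i + j) (by omega)] at h1
  rcases Nat.eq_zero_or_pos j with rfl | hj
  · simp at h1 ⊢
    omega
  · rw [hg j (by omega)] at h1
    nlinarith

theorem le_of_norm_pow_lt (hg : ∀ n : ℕ, n ≠ 0 → norm (g ^ n) = n * τ + 2 * κ)
    {i N : ℕ} (hi : i ≠ 0) (h : norm (g ^ i) < norm (g ^ N)) : i ≤ N := by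
  by_contra hlt
  rcases Nat.eq_zero_or_pos N with rfl | hN
  · simp at h
  · rw [hg i hi, hg N (by omega)] at h
    nlinarith

/-- If no power of `g` lies in a quasiconvex subgroup, then the elements of the subgroup have
bounded overlap with the powers of `g`. -/
theorem exists_gromov_pow_le [Finite α] {H : Subgroup (FreeGroup α)} {R : ℕ}
    (hH : IsQuasiconvex H R) (g : FreeGroup α) (hgH : ∀ n : ℕ, n ≠ 0 → g ^ n ∉ H) :
    ∃ T, ∀ N : ℕ, ∀ δ ∈ H, gromov (g ^ N) δ ≤ T := by
  have hg1 : g ≠ 1 := by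
    rintro rfl
    exact hgH 1 one_ne_zero (by simp)
  obtain ⟨τ, κ, -, hg⟩ := exists_norm_pow hg1
  by_contra! hT
  -- A long overlap passes within κ of `g ^ (i + 1)`, and quasiconvexity finds a point of H within R
  -- of the place where it passes. Two indices with the same f then put a nontrivial power of g in
  -- H.
  have claim : ∀ i : ℕ, ∃ f : FreeGroup α, norm f ≤ R + κ ∧ g ^ (i + 1) * f⁻¹ ∈ H := by
    intro i
    obtain ⟨N, δ, hδ, hN⟩ := hT (norm (g ^ (i + 1)))
    have hiN := le_of_norm_pow_lt hg i.succ_ne_zero (hN.trans_le (gromov_le_left _ _))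
    have h1 := norm_pow_sub_le_gromov hg i.succ_ne_zero hiN
    have hi := hg (i + 1) i.succ_ne_zero
    have h2 : (i + 1) * τ + κ ≤ gromov (g ^ (i + 1)) δ := le_gromov_trans h1 (by omega)
    obtain ⟨p, hp, hpg, hpδ⟩ := exists_common_prefix h2
    obtain ⟨b, hb, hpb⟩ := hH δ hδ p hpδ
    refine ⟨b * (p⁻¹ * g ^ (i + 1)), ?_, ?_⟩
    · have := norm_mul_le b (p⁻¹ * g ^ (i + 1))
      unfold IsPrefix at hpg
      omega
    · convert hpb using 1
      group
  choose f hf hfH using claim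
  have hfin : Finite {x : FreeGroup α | norm x ≤ R + κ} := finite_setOf_norm_le _
  obtain ⟨i, j, hij, hfij⟩ := Finite.exists_ne_map_eq_of_infinite
    (fun i => (⟨f i, hf i⟩ : {x : FreeGroup α | norm x ≤ R + κ}))
  wlog hlt : i < j generalizing i j
  · exact this j i hij.symm hfij.symm (by omega)
  simp only [Subtype.mk.injEq] at hfij
  obtain ⟨k, rfl⟩ := Nat.exists_eq_add_of_lt hlt
  apply hgH (k + 1) k.succ_ne_zero
  have h1 := hfH i
  rw [hfij] at h1
  convert mul_mem (hfH (i + k + 1)) (inv_mem h1) using 1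
  rw [mul_inv_rev, inv_inv, mul_assoc, inv_mul_cancel_left, eq_mul_inv_iff_mul_eq, ← pow_add]
  congr 1
  omega

theorem exists_gromov_zpow_le [Finite α] {H : Subgroup (FreeGroup α)} {R : ℕ}
    (hH : IsQuasiconvex H R) (g : FreeGroup α) (hgH : ∀ n : ℕ, n ≠ 0 → g ^ n ∉ H) :
    ∃ T, ∀ N : ℤ, ∀ δ ∈ H, gromov (g ^ N) δ ≤ T := by
  obtain ⟨T, hT⟩ := exists_gromov_pow_le hH g hgH
  obtain ⟨T', hT'⟩ := exists_gromov_pow_le hH g⁻¹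
    (fun n hn h => hgH n hn (by simpa using h))
  refine ⟨max T T', fun N δ hδ => ?_⟩
  obtain ⟨n, rfl | rfl⟩ := N.eq_nat_or_neg
  · rw [zpow_natCast]
    exact (hT n δ hδ).trans (le_max_left _ _)
  · rw [zpow_neg, zpow_natCast, ← inv_pow]
    exact (hT' n δ hδ).trans (le_max_right _ _)

/-- Pigeonhole again: if the two rays overlap arbitrarily far, equal speeds keep g^(-i) v h^i in a
fixed finite ball, and a repetition between two values of i gives the conjugacy. It is applied with
h equal to g or g⁻¹ or with g inverted, which all share τ and κ. -/
theorem gromov_pow_le_or_conj [Finite α] {h : FreeGroup α}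
    (hg : ∀ n : ℕ, n ≠ 0 → norm (g ^ n) = n * τ + 2 * κ)
    (hh : ∀ n : ℕ, n ≠ 0 → norm (h ^ n) = n * τ + 2 * κ) (v : FreeGroup α) :
    (∃ C, ∀ N M : ℕ, gromov (g ^ N) (v * h ^ M) ≤ C) ∨
      ∃ a : ℕ, a ≠ 0 ∧ v * h ^ a * v⁻¹ = g ^ a := by
  by_contra! hcon
  obtain ⟨hC, hne⟩ := hcon
  have claim : ∀ i : ℕ, norm ((g ^ (i + 1))⁻¹ * (v * h ^ (i + 1))) ≤ 2 * κ + 5 * norm v := by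
    intro i
    obtain ⟨N, M, hNM⟩ := hC (norm (g ^ (i + 1)) + norm v + norm (h ^ (i + 1)))
    have hi : i + 1 ≠ 0 := i.succ_ne_zero
    have a1 := gromov_le_left (g ^ N) (v * h ^ M)
    have a2 := gromov_le_right (g ^ N) (v * h ^ M)
    have a3 := norm_mul_le v (h ^ M)
    have hN : i + 1 ≤ N := le_of_norm_pow_lt hg hi (by omega)
    have hM : i + 1 ≤ M := le_of_norm_pow_lt hh hi (by omega)
    have b1 := norm_pow_sub_le_gromov hg hi hN
    have b2 := norm_pow_sub_le_gromov hh hi hM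
    have c1 := norm_inv_mul_add (v * h ^ (i + 1)) (v * h ^ M)
    have c2 := norm_inv_mul_add (h ^ (i + 1)) (h ^ M)
    have e : (v * h ^ (i + 1))⁻¹ * (v * h ^ M) = (h ^ (i + 1))⁻¹ * h ^ M := by group
    rw [e] at c1
    have d1 : norm (h ^ M) ≤ norm v + norm (v * h ^ M) := by
      have := norm_mul_le v⁻¹ (v * h ^ M)
      rwa [inv_mul_cancel_left, norm_inv_eq] at this
    have d2 : norm (h ^ (i + 1)) ≤ norm v + norm (v * h ^ (i + 1)) := by
      have := norm_mul_le v⁻¹ (v * h ^ (i + 1))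
      rwa [inv_mul_cancel_left, norm_inv_eq] at this
    have d3 := norm_mul_le v (h ^ (i + 1))
    have n1 := hg (i + 1) hi
    have n2 := hh (i + 1) hi
    have k1 : (i + 1) * τ + κ - 2 * norm v ≤ gromov (g ^ (i + 1)) (v * h ^ (i + 1)) := by
      refine le_gromov_trans (y := g ^ N) (by omega)
        (le_gromov_trans (y := v * h ^ M) (by omega) ?_)
      rw [gromov_comm]
      omega
    have := norm_inv_mul_add (g ^ (i + 1)) (v * h ^ (i + 1))
    omega
  have hfin : Finite {x : FreeGroup α | norm x ≤ 2 * κ + 5 * norm v} := finite_setOf_norm_le _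
  obtain ⟨i, j, hij, hfij⟩ := Finite.exists_ne_map_eq_of_infinite
    (fun i => (⟨_, claim i⟩ : {x : FreeGroup α | norm x ≤ 2 * κ + 5 * norm v}))
  wlog hlt : i < j generalizing i j
  · exact this j i hij.symm hfij.symm (by omega)
  simp only [Subtype.mk.injEq] at hfij
  obtain ⟨k, rfl⟩ := Nat.exists_eq_add_of_lt hlt
  apply hne (k + 1) k.succ_ne_zero
  have eg : g ^ (i + k + 1 + 1) = g ^ (i + 1) * g ^ (k + 1) := by rw [← pow_add]; congr 1; omega
  have eh : h ^ (i + k + 1 + 1) = h ^ (k + 1) * h ^ (i + 1) := by rw [← pow_add]; congr 1; omega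
  rw [eg, eh, mul_inv_rev, inv_mul_eq_iff_eq_mul] at hfij
  have : v * h ^ (i + 1) = ((g ^ (k + 1))⁻¹ * v * h ^ (k + 1)) * h ^ (i + 1) := by
    rw [hfij]; group
  have := mul_right_cancel this
  rw [mul_inv_eq_iff_eq_mul, eq_comm]
  nth_rewrite 1 [this]
  group

end Powers

theorem norm_inv_pow_of {g : FreeGroup α} {τ κ : ℕ}
    (hg : ∀ n : ℕ, n ≠ 0 → norm (g ^ n) = n * τ + 2 * κ) :
    ∀ n : ℕ, n ≠ 0 → norm (g⁻¹ ^ n) = n * τ + 2 * κ := by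
  intro n hn
  rw [inv_pow, norm_inv_eq, hg n hn]

/-- Either `v` moves the axis of `g` to an axis with bounded overlap, or `v` and `g` have a common
power. -/
theorem gromov_zpow_le_or_common_power [Finite α] {g v : FreeGroup α} (hg : g ≠ 1) (hv : v ≠ 1) :
    (∃ C, ∀ N M : ℤ, gromov (g ^ N) (v * g ^ M) ≤ C) ∨
      ∃ n k : ℕ, k ≠ 0 ∧ (v ^ n = g ^ k ∨ v ^ n = (g ^ k)⁻¹) := by
  -- Even if v flips the axis, v² commutes with g^a, and commuting nontrivial elements have a common
  -- power.
  have key : ∀ a : ℕ, a ≠ 0 → (v * g ^ a * v⁻¹ = g ^ a ∨ v * g ^ a * v⁻¹ = g⁻¹ ^ a) →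
      ∃ n k : ℕ, k ≠ 0 ∧ (v ^ n = g ^ k ∨ v ^ n = (g ^ k)⁻¹) := by
    intro a ha h
    have hcomm : Commute (v ^ 2) (g ^ a) := by
      have : v ^ 2 * g ^ a * (v ^ 2)⁻¹ = v * (v * g ^ a * v⁻¹) * v⁻¹ := by
        simp [pow_two, mul_assoc]
      show v ^ 2 * g ^ a = g ^ a * v ^ 2
      rw [← mul_inv_eq_iff_eq_mul, this]
      rcases h with h | h
      · rw [h, h]
      · rw [h, inv_pow]
        have h' := congrArg (·⁻¹) h
        simp only [inv_pow, inv_inv] at h'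
        nth_rewrite 2 [← h']
        simp [mul_assoc]
    obtain ⟨p, q, hp, hq, hpq⟩ := exists_pow_eq_zpow_of_commute hcomm
      (by simpa using hv) (by simpa [ha] using hg)
    have hpq' : (v ^ 2) ^ p.natAbs = (g ^ a) ^ q.natAbs ∨
        (v ^ 2) ^ p.natAbs = ((g ^ a) ^ q.natAbs)⁻¹ := by
      rcases p.natAbs_eq with h1 | h1 <;> rcases q.natAbs_eq with h2 | h2 <;>
        rw [h1, h2] at hpq <;>
        simp only [zpow_neg, zpow_natCast, inv_eq_iff_eq_inv, inv_inv] at hpq ⊢ <;> simp [hpq]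
    refine ⟨2 * p.natAbs, a * q.natAbs, by simp [ha, hq], ?_⟩
    simpa only [pow_mul] using hpq'
  obtain ⟨τ, κ, -, h1⟩ := exists_norm_pow hg
  have h2 := norm_inv_pow_of h1
  rcases gromov_pow_le_or_conj h1 h1 v with ⟨C1, hC1⟩ | ⟨a, ha, h⟩
  swap; · exact Or.inr (key a ha (Or.inl h))
  rcases gromov_pow_le_or_conj h1 h2 v with ⟨C2, hC2⟩ | ⟨a, ha, h⟩
  swap
  · refine Or.inr (key a ha (Or.inr ?_))
    have h' := congrArg (·⁻¹) h
    simp only [inv_pow] at h' ⊢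
    rw [← h']
    group
  rcases gromov_pow_le_or_conj h2 h1 v with ⟨C3, hC3⟩ | ⟨a, ha, h⟩
  swap; · exact Or.inr (key a ha (Or.inr h))
  rcases gromov_pow_le_or_conj h2 h2 v with ⟨C4, hC4⟩ | ⟨a, ha, h⟩
  swap
  · refine Or.inr (key a ha (Or.inl ?_))
    have h' := congrArg (·⁻¹) h
    simp only [inv_pow, inv_inv] at h'
    nth_rewrite 2 [← h']
    simp [mul_assoc]
  refine Or.inl ⟨C1 + C2 + C3 + C4, fun N M => ?_⟩
  obtain ⟨n, rfl | rfl⟩ := N.eq_nat_or_neg <;> obtain ⟨m, rfl | rfl⟩ := M.eq_nat_or_neg <;>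
    simp only [zpow_neg, zpow_natCast, ← inv_pow]
  · exact (hC1 n m).trans (by omega)
  · exact (hC2 n m).trans (by omega)
  · exact (hC3 n m).trans (by omega)
  · exact (hC4 n m).trans (by omega)

/-- The axes of `g` and of its conjugates by the nontrivial elements of a quasiconvex subgroup
without powers of `g` have uniformly bounded overlap. -/
theorem exists_gromov_zpow_mul_le [Finite α] {H : Subgroup (FreeGroup α)} {R : ℕ}
    (hH : IsQuasiconvex H R) (g : FreeGroup α) (hgH : ∀ n : ℕ, n ≠ 0 → g ^ n ∉ H) :
    ∃ C, ∀ δ ∈ H, ∀ N M : ℤ, (δ ≠ 1 ∨ M = 0) → gromov (g ^ N) (δ * g ^ M) ≤ C := by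
  have hg1 : g ≠ 1 := by
    rintro rfl
    exact hgH 1 one_ne_zero (by simp)
  obtain ⟨T, hT⟩ := exists_gromov_zpow_le hH g hgH
  have hsmall : ∀ v : FreeGroup α, ∃ C, v ∈ H → v ≠ 1 →
      ∀ N M : ℤ, gromov (g ^ N) (v * g ^ M) ≤ C := by
    intro v
    by_cases hv : v ∈ H ∧ v ≠ 1
    · rcases gromov_zpow_le_or_common_power hg1 hv.2 with ⟨C, hC⟩ | ⟨n, k, hk, h⟩
      · exact ⟨C, fun _ _ => hC⟩
      · exfalso
        have hvn := pow_mem hv.1 n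
        rcases h with h | h
        · exact hgH k hk (h ▸ hvn)
        · exact hgH k hk (by rw [h] at hvn; simpa using hvn)
    · exact ⟨0, fun h1 h2 => absurd ⟨h1, h2⟩ hv⟩
  choose C hC using hsmall
  -- Only finitely many δ have length at most 2T, and each has its own bound. A longer δ shares more
  -- than T letters with `δ * g ^ M`, so an excessive overlap would already occur between `g ^ N`
  -- and δ.
  let S := (finite_setOf_norm_le (α := α) (2 * T)).toFinset
  refine ⟨T + S.sup C, fun δ hδ N M hM => ?_⟩
  by_cases h1 : δ = 1
  · have hM : M = 0 := by tauto
    subst hM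
    have := hT N 1 (one_mem _)
    subst h1
    simp
  by_cases hlen : norm δ ≤ 2 * T
  · have : C δ ≤ S.sup C := Finset.le_sup (by simpa [S] using hlen)
    have := hC δ hδ h1 N M
    omega
  · by_contra hlt
    have a1 := gromov_mul_add δ (g ^ M)
    have a2 := hT M δ⁻¹ (inv_mem hδ)
    rw [gromov_comm] at a2
    have a3 : T + 1 ≤ gromov (g ^ N) δ :=
      le_gromov_trans (y := δ * g ^ M) (by omega) (by rw [gromov_comm]; omega)
    have := hT N δ hδ
    omega

end FreeGroup

/-! ### Exponential weights and Poincaré series with values in [0, ∞]. -/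

/-- The weight `exp (-s * n)`, as an extended nonnegative real. -/
def expWeight (s : ℝ) (n : ℕ) : ℝ≥0∞ := ENNReal.ofReal (Real.exp (-s * n))

theorem expWeight_zero (s : ℝ) : expWeight s 0 = 1 := by simp [expWeight]

theorem expWeight_add (s : ℝ) (m n : ℕ) :
    expWeight s (m + n) = expWeight s m * expWeight s n := by
  rw [expWeight, expWeight, expWeight, ← ENNReal.ofReal_mul (Real.exp_pos _).le, ← Real.exp_add]
  congr 2
  push_cast
  ring

theorem expWeight_mul (s : ℝ) (m n : ℕ) : expWeight s (m * n) = expWeight s m ^ n := by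
  induction n with
  | zero => simp [expWeight_zero]
  | succ n ih => rw [Nat.mul_succ, expWeight_add, ih, pow_succ]

theorem expWeight_ne_top (s : ℝ) (n : ℕ) : expWeight s n ≠ ∞ := ENNReal.ofReal_ne_top

theorem expWeight_anti {s : ℝ} (hs : 0 ≤ s) {m n : ℕ} (h : m ≤ n) :
    expWeight s n ≤ expWeight s m := by
  apply ENNReal.ofReal_le_ofReal
  apply Real.exp_le_exp.2
  have : (m : ℝ) ≤ n := by exact_mod_cast h
  nlinarith

theorem expWeight_anti_exponent {s t : ℝ} (h : s ≤ t) (n : ℕ) :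
    expWeight t n ≤ expWeight s n := by
  apply ENNReal.ofReal_le_ofReal
  apply Real.exp_le_exp.2
  have : (0 : ℝ) ≤ n := by positivity
  nlinarith

theorem expWeight_neg_mul (s : ℝ) (n : ℕ) : expWeight (-s) n * expWeight s n = 1 := by
  rw [expWeight, expWeight, ← ENNReal.ofReal_mul (Real.exp_pos _).le, ← Real.exp_add]
  simp

theorem tendsto_expWeight {s : ℝ} (hs : 0 < s) : Tendsto (expWeight s) atTop (𝓝 0) := by
  rw [← ENNReal.ofReal_zero]
  apply ENNReal.tendsto_ofReal
  apply Real.tendsto_exp_atBot.comp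
  exact Tendsto.const_mul_atTop_of_neg (by linarith) tendsto_natCast_atTop_atTop

/-- The Poincaré series `∑ exp (-s * len z)` over a set `Z`. -/
def poincare {β : Type*} (len : β → ℕ) (s : ℝ) (Z : Set β) : ℝ≥0∞ :=
  ∑' z : Z, expWeight s (len z)

section Poincare

variable {β γ : Type*} {len : β → ℕ} {s : ℝ}

theorem poincare_mono {Z Z' : Set β} (h : Z ⊆ Z') : poincare len s Z ≤ poincare len s Z' :=
  ENNReal.tsum_mono_subtype (fun z => expWeight s (len z)) h

theorem poincare_union_le (Z Z' : Set β) :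
    poincare len s (Z ∪ Z') ≤ poincare len s Z + poincare len s Z' :=
  ENNReal.tsum_union_le (fun z => expWeight s (len z)) Z Z'

theorem poincare_iUnion_le {ι : Type*} (Z : ι → Set β) :
    poincare len s (⋃ i, Z i) ≤ ∑' i, poincare len s (Z i) :=
  ENNReal.tsum_iUnion_le_tsum (fun z => expWeight s (len z)) Z

theorem poincare_range_le (f : γ → β) :
    poincare len s (Set.range f) ≤ ∑' c, expWeight s (len (f c)) := by
  have h := ENNReal.tsum_comp_le_tsum_of_injective
    (f := fun z : Set.range f => z.2.choose)
    (fun a b hab => by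
      have hab : a.2.choose = b.2.choose := hab
      apply Subtype.ext
      rw [← a.2.choose_spec, ← b.2.choose_spec, hab])
    (fun c => expWeight s (len (f c)))
  refine le_trans (le_of_eq ?_) h
  refine tsum_congr fun z => ?_
  have : f z.2.choose = z := z.2.choose_spec
  simp only [this]

theorem poincare_anti_exponent {t : ℝ} (h : s ≤ t) (Z : Set β) :
    poincare len t Z ≤ poincare len s Z :=
  ENNReal.tsum_le_tsum fun _ => expWeight_anti_exponent h _

theorem poincare_ne_top_of_finite {Z : Set β} (h : Z.Finite) : poincare len s Z ≠ ∞ := by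
  have := h.fintype
  rw [poincare, tsum_fintype]
  exact ENNReal.sum_ne_top.2 fun _ _ => expWeight_ne_top _ _

end Poincare

theorem tsum_int_ne_zero_le {q : ℝ≥0∞} (hq : q ≤ 2⁻¹) :
    ∑' k : {k : ℤ // k ≠ 0}, q ^ k.1.natAbs ≤ 4 * q := by
  have h := ENNReal.tsum_comp_le_tsum_of_injective
    (f := fun k : {k : ℤ // k ≠ 0} => (decide (0 ≤ k.1), k.1.natAbs - 1))
    (by
      rintro ⟨a, ha⟩ ⟨b, hb⟩ hab
      simp only [Prod.mk.injEq, decide_eq_decide] at hab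
      simp only [Subtype.mk.injEq]
      omega)
    (fun p : Bool × ℕ => q ^ (p.2 + 1))
  refine le_trans (ENNReal.tsum_le_tsum fun k => le_of_eq ?_) (h.trans ?_)
  · have := k.2
    simp only
    congr 1
    omega
  rw [ENNReal.tsum_prod', tsum_fintype]
  simp only [Fintype.sum_bool, pow_succ, ENNReal.tsum_mul_right, ENNReal.tsum_geometric]
  have h2 : (1 - q)⁻¹ ≤ 2 := by
    rw [ENNReal.inv_le_iff_inv_le]
    have : (1 : ℝ≥0∞) - 2⁻¹ = 2⁻¹ := ENNReal.one_sub_inv_two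
    rw [← this]
    exact tsub_le_tsub_left hq 1
  calc (1 - q)⁻¹ * q + (1 - q)⁻¹ * q ≤ 2 * q + 2 * q := by gcongr
    _ = 4 * q := by rw [← add_mul]; norm_num

namespace FreeGroup

variable {α : Type*} [DecidableEq α]

/-! ### Adjoining a high power of an element to a subgroup. -/

section NormalForms

/-- The products `δ₁ h^k₁ δ₂ h^k₂ ⋯ δᵣ h^kᵣ δ` with `δᵢ ∈ H`, `δᵢ ≠ 1`, `kᵢ ≠ 0` and `δ ∈ H`. -/
def alternatingProducts (H : Subgroup (FreeGroup α)) (h : FreeGroup α) : ℕ → Set (FreeGroup α)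
  | 0 => H
  | r + 1 => {x | ∃ δ ∈ H, δ ≠ 1 ∧ ∃ k : ℤ, k ≠ 0 ∧ ∃ w ∈ alternatingProducts H h r,
      x = δ * h ^ k * w}

/-- Only the leading factor from H may be trivial; multiplying by a generator on the left then
changes that factor or merges two powers of h. Uniqueness is not needed, since the Poincaré series
is only bounded from above. -/
theorem mem_sup_zpowers_imp {H : Subgroup (FreeGroup α)} {h x : FreeGroup α}
    (hx : x ∈ H ⊔ Subgroup.zpowers h) :
    x ∈ H ∨ ∃ r, ∃ δ ∈ H, ∃ k : ℤ, k ≠ 0 ∧ ∃ w ∈ alternatingProducts H h r,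
      x = δ * h ^ k * w := by
  rw [← Subgroup.closure_eq H, Subgroup.zpowers_eq_closure, ← Subgroup.closure_union] at hx
  have hpow : ∀ k : ℤ, k ≠ 0 → ∀ y, (y ∈ H ∨ ∃ r, ∃ δ ∈ H, ∃ k : ℤ, k ≠ 0 ∧
      ∃ w ∈ alternatingProducts H h r, y = δ * h ^ k * w) →
      (h ^ k * y ∈ H ∨ ∃ r, ∃ δ ∈ H, ∃ j : ℤ, j ≠ 0 ∧
      ∃ w ∈ alternatingProducts H h r, h ^ k * y = δ * h ^ j * w) := by
    rintro k hk y (hy | ⟨r, δ, hδ, j, hj, w, hw, rfl⟩)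
    · exact Or.inr ⟨0, 1, one_mem _, k, hk, y, hy, by simp⟩
    · by_cases h1 : δ = 1
      · subst h1
        by_cases hkj : k + j = 0
        · have e : h ^ k * (1 * h ^ j * w) = w := by
            rw [one_mul, ← mul_assoc, ← zpow_add, hkj, zpow_zero, one_mul]
          rw [e]
          cases r with
          | zero => exact Or.inl hw
          | succ r =>
            obtain ⟨δ, hδ, -, i, hi, v, hv, rfl⟩ := hw
            exact Or.inr ⟨r, δ, hδ, i, hi, v, hv, rfl⟩
        · refine Or.inr ⟨r, 1, one_mem _, k + j, hkj, w, hw, ?_⟩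
          rw [zpow_add]
          group
      · exact Or.inr ⟨r + 1, 1, one_mem _, k, hk, _, ⟨δ, hδ, h1, j, hj, w, hw, rfl⟩, by group⟩
  induction hx using Subgroup.closure_induction_left with
  | one => exact Or.inl (one_mem _)
  | mul_left x hx y _ ih =>
    rcases hx with hx | hx
    · rcases ih with hy | ⟨r, δ, hδ, j, hj, w, hw, rfl⟩
      · exact Or.inl (mul_mem hx hy)
      · exact Or.inr ⟨r, x * δ, mul_mem hx hδ, j, hj, w, hw, by group⟩
    · rw [Set.mem_singleton_iff.1 hx]
      simpa using hpow 1 one_ne_zero y ih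
  | inv_mul_cancel x hx y _ ih =>
    rcases hx with hx | hx
    · rcases ih with hy | ⟨r, δ, hδ, j, hj, w, hw, rfl⟩
      · exact Or.inl (mul_mem (inv_mem hx) hy)
      · exact Or.inr ⟨r, x⁻¹ * δ, mul_mem (inv_mem hx) hδ, j, hj, w, hw, by group⟩
    · rw [Set.mem_singleton_iff.1 hx]
      simpa using hpow (-1) (by norm_num) y ih

variable {H : Subgroup (FreeGroup α)} {g : FreeGroup α} {C : ℕ}

/-- At most C letters cancel against each other at either end of `g ^ M`, which costs 2C in length
each time. As `g ^ M` is longer than 4C it is not swallowed, and the second conclusion is the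
hypothesis on w needed to prepend the next syllable. -/
theorem norm_le_norm_mul_zpow_mul
    (hC : ∀ δ ∈ H, ∀ N M : ℤ, (δ ≠ 1 ∨ M = 0) → gromov (g ^ N) (δ * g ^ M) ≤ C)
    {δ w : FreeGroup α} (hδ : δ ∈ H) {M : ℤ} (hM : 4 * C < norm (g ^ M))
    (hw : ∀ N : ℤ, gromov (g ^ N) w ≤ C) :
    norm δ + norm (g ^ M) + norm w ≤ norm (δ * g ^ M * w) + 4 * C ∧
      (δ ≠ 1 → ∀ N : ℤ, gromov (g ^ N) (δ * g ^ M * w) ≤ C) := by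
  have a1 := norm_mul_add δ (g ^ M)
  have a2 : gromov (g ^ M) δ⁻¹ ≤ C := by simpa using hC δ⁻¹ (inv_mem hδ) M 0 (Or.inr rfl)
  have a3 := gromov_comm (g ^ M) δ⁻¹
  have b1 := norm_mul_add (δ * g ^ M) w
  have c1 := gromov_mul_add (g ^ (-M)) δ⁻¹
  rw [zpow_neg, inv_inv, norm_inv_eq, ← zpow_neg] at c1
  -- The inverse begins with more than C letters of `g ^ (-M)`, so a larger overlap with w would be
  -- an overlap of w with a power of g.
  have b2 : gromov (δ * g ^ M)⁻¹ w ≤ C := by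
    by_contra hlt
    have e : (δ * g ^ M)⁻¹ = g ^ (-M) * δ⁻¹ := by group
    rw [e] at hlt
    have : C + 1 ≤ gromov (g ^ (-M)) w :=
      le_gromov_trans (y := g ^ (-M) * δ⁻¹) (by omega) (by omega)
    have := hw (-M)
    omega
  refine ⟨by omega, fun h1 N => ?_⟩
  by_contra hlt
  have d1 := gromov_mul_add (δ * g ^ M) w
  have : C + 1 ≤ gromov (g ^ N) (δ * g ^ M) :=
    le_gromov_trans (y := δ * g ^ M * w) (by omega) (by rw [gromov_comm]; omega)
  have := hC δ hδ N M (Or.inl h1)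
  omega

theorem gromov_zpow_alternatingProducts_le
    (hC : ∀ δ ∈ H, ∀ N M : ℤ, (δ ≠ 1 ∨ M = 0) → gromov (g ^ N) (δ * g ^ M) ≤ C)
    {m : ℕ} (hm : ∀ k : ℤ, k ≠ 0 → 4 * C < norm ((g ^ m) ^ k)) (r : ℕ) :
    ∀ w ∈ alternatingProducts H (g ^ m) r, ∀ N : ℤ, gromov (g ^ N) w ≤ C := by
  induction r with
  | zero =>
    intro w hw N
    simpa using hC w hw N 0 (Or.inr rfl)
  | succ r ih =>
    rintro w ⟨δ, hδ, h1, k, hk, w, hw, rfl⟩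
    have := hm k hk
    rw [← zpow_natCast, ← zpow_mul] at this ⊢
    exact (norm_le_norm_mul_zpow_mul hC hδ this (ih w hw)).2 h1

/-- The loss of 4C in length becomes the factor `expWeight (-s) (4 * C)`; the remaining sum factors
over the three coordinates. -/
theorem poincare_alternating_step {s : ℝ} (hs : 0 < s)
    (hC : ∀ δ ∈ H, ∀ N M : ℤ, (δ ≠ 1 ∨ M = 0) → gromov (g ^ N) (δ * g ^ M) ≤ C)
    {m : ℕ} (hm : ∀ k : ℤ, k ≠ 0 → 4 * C < norm ((g ^ m) ^ k)) (r : ℕ) :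
    poincare norm s {x | ∃ δ ∈ H, ∃ k : ℤ, k ≠ 0 ∧ ∃ w ∈ alternatingProducts H (g ^ m) r,
      x = δ * (g ^ m) ^ k * w} ≤
    poincare norm s (H : Set (FreeGroup α)) * (expWeight (-s) (4 * C) *
      ∑' k : {k : ℤ // k ≠ 0}, expWeight s (norm ((g ^ m) ^ k.1))) *
      poincare norm s (alternatingProducts H (g ^ m) r) := by
  let f : H × {k : ℤ // k ≠ 0} × alternatingProducts H (g ^ m) r → FreeGroup α :=
    fun p => p.1 * (g ^ m) ^ p.2.1.1 * p.2.2
  have hsub : {x | ∃ δ ∈ H, ∃ k : ℤ, k ≠ 0 ∧ ∃ w ∈ alternatingProducts H (g ^ m) r,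
      x = δ * (g ^ m) ^ k * w} ⊆ Set.range f := by
    rintro x ⟨δ, hδ, k, hk, w, hw, rfl⟩
    exact ⟨(⟨δ, hδ⟩, ⟨k, hk⟩, ⟨w, hw⟩), rfl⟩
  refine (poincare_mono hsub).trans ((poincare_range_le f).trans ?_)
  calc ∑' c, expWeight s (norm (f c))
      ≤ ∑' c : H × {k : ℤ // k ≠ 0} × alternatingProducts H (g ^ m) r,
        expWeight s (norm (c.1 : FreeGroup α)) * (expWeight (-s) (4 * C) *
          expWeight s (norm ((g ^ m) ^ c.2.1.1)) * expWeight s (norm (c.2.2 : FreeGroup α))) := by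
        refine ENNReal.tsum_le_tsum fun c => ?_
        obtain ⟨⟨δ, hδ⟩, ⟨k, hk⟩, ⟨w, hw⟩⟩ := c
        have h1 := hm k hk
        have h2 := gromov_zpow_alternatingProducts_le hC hm r w hw
        simp only [f]
        rw [← zpow_natCast, ← zpow_mul] at h1 ⊢
        have h3 := (norm_le_norm_mul_zpow_mul hC hδ h1 h2).1
        have h4 := expWeight_anti hs.le h3
        rw [expWeight_add, expWeight_add, expWeight_add] at h4
        calc expWeight s (norm (δ * g ^ ((m : ℤ) * k) * w))
            = expWeight (-s) (4 * C) * (expWeight s (norm (δ * g ^ ((m : ℤ) * k) * w)) *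
              expWeight s (4 * C)) := by
              rw [mul_comm (expWeight s _) (expWeight s (4 * C)), ← mul_assoc,
                expWeight_neg_mul, one_mul]
          _ ≤ expWeight (-s) (4 * C) * (expWeight s (norm δ) *
              expWeight s (norm (g ^ ((m : ℤ) * k))) * expWeight s (norm w)) := by gcongr
          _ = _ := by ring
    _ = _ := by
        rw [ENNReal.tsum_prod']
        simp_rw [ENNReal.tsum_mul_left]
        rw [ENNReal.tsum_mul_right, ENNReal.tsum_prod']
        simp_rw [ENNReal.tsum_mul_left]
        rw [ENNReal.tsum_mul_right, ENNReal.tsum_mul_left]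
        simp only [poincare, SetLike.coe_sort_coe]
        ring

end NormalForms

/-- A finitely generated subgroup with convergent Poincaré series can be enlarged to contain a
power of a given element, with an arbitrarily small change of the Poincaré series. -/
theorem exists_adjoin_pow [Finite α] {H : Subgroup (FreeGroup α)} (hH : H.FG) {s : ℝ}
    (hs : 0 < s) (hW : poincare norm s (H : Set (FreeGroup α)) ≠ ∞) (g : FreeGroup α) (R : ℕ)
    {ε : ℝ≥0∞} (hε : ε ≠ 0) :
    ∃ H' : Subgroup (FreeGroup α), H ≤ H' ∧ H'.FG ∧ (∃ m : ℕ, m ≠ 0 ∧ g ^ m ∈ H') ∧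
      poincare norm s (H' : Set (FreeGroup α)) ≤ poincare norm s (H : Set (FreeGroup α)) + ε ∧
      ∀ x ∈ H', norm x ≤ R → x ∈ H := by
  by_cases hgH : ∃ m : ℕ, m ≠ 0 ∧ g ^ m ∈ H
  · exact ⟨H, le_rfl, hH, hgH, le_self_add, fun x hx _ => hx⟩
  push Not at hgH
  have hg1 : g ≠ 1 := by
    rintro rfl
    exact hgH 1 one_ne_zero (by simp)
  obtain ⟨τ, κ, hτ, hnorm⟩ := exists_norm_pow hg1
  obtain ⟨Q, hQ⟩ := exists_isQuasiconvex hH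
  obtain ⟨C, hC⟩ := exists_gromov_zpow_mul_le hQ g hgH
  set S := poincare norm s (H : Set (FreeGroup α)) with hS
  have hpow : ∀ m : ℕ, ∀ k : ℤ, k ≠ 0 → m ≠ 0 → m * k.natAbs ≤ norm ((g ^ m) ^ k) := by
    intro m k hk hm
    have h0 : m * k.natAbs ≠ 0 := by simp [hm, hk]
    have h1 : norm ((g ^ m) ^ k) = norm (g ^ (m * k.natAbs)) := by
      rcases k.natAbs_eq with h | h
      · rw [h, zpow_natCast, ← pow_mul, Int.natAbs_natCast]
      · rw [h, zpow_neg, norm_inv_eq, zpow_natCast, ← pow_mul, Int.natAbs_neg,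
          Int.natAbs_natCast]
    rw [h1, hnorm _ h0]
    exact (Nat.le_mul_of_pos_right _ hτ).trans (Nat.le_add_right _ _)
  let A := expWeight (-s) (4 * C) * 4
  have hA : A ≠ ∞ := ENNReal.mul_ne_top (expWeight_ne_top _ _) (by norm_num)
  have ht := tendsto_expWeight hs
  have t1 : ∀ᶠ m in atTop, expWeight s m ≤ 2⁻¹ :=
    ht.eventually (Iic_mem_nhds (by norm_num))
  have t2 : ∀ᶠ m in atTop, S * A * expWeight s m ≤ 2⁻¹ := by
    have := ENNReal.Tendsto.const_mul (a := S * A) ht (Or.inr (ENNReal.mul_ne_top hW hA))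
    rw [mul_zero] at this
    exact this.eventually (Iic_mem_nhds (by norm_num))
  have t3 : ∀ᶠ m in atTop, (S * S * A * 2) * expWeight s m ≤ ε := by
    have := ENNReal.Tendsto.const_mul (a := S * S * A * 2) ht (Or.inr (by finiteness))
    rw [mul_zero] at this
    exact this.eventually (Iic_mem_nhds (pos_iff_ne_zero.2 hε))
  -- `m1` bounds the sum over exponents of `g ^ m`, `m2` makes the ratio of the geometric series at
  -- most 1/2, `m3` makes its total at most ε, and `m4` keeps new elements out of the ball of radius
  -- R.
  obtain ⟨m, m1, m2, m3, m4⟩ :=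
    (t1.and (t2.and (t3.and (eventually_gt_atTop (4 * C + R))))).exists
  have hm0 : m ≠ 0 := by omega
  have hm : ∀ k : ℤ, k ≠ 0 → m ≤ norm ((g ^ m) ^ k) := by
    intro k hk
    have h1 := hpow m k hk hm0
    have h2 : 1 ≤ k.natAbs := by omega
    nlinarith
  have hmC : ∀ k : ℤ, k ≠ 0 → 4 * C < norm ((g ^ m) ^ k) := fun k hk => by
    have := hm k hk
    omega
  set Ω := expWeight (-s) (4 * C) *
    ∑' k : {k : ℤ // k ≠ 0}, expWeight s (norm ((g ^ m) ^ k.1)) with hΩ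
  have hΩle : Ω ≤ A * expWeight s m := by
    rw [hΩ, mul_assoc]
    gcongr
    refine le_trans (ENNReal.tsum_le_tsum fun k => ?_) (tsum_int_ne_zero_le m1)
    rw [← expWeight_mul]
    exact expWeight_anti hs.le (hpow m k.1 k.2 hm0)
  have hSΩ : S * Ω ≤ 2⁻¹ := by
    refine le_trans ?_ m2
    rw [mul_assoc]
    gcongr
  let M : ℕ → Set (FreeGroup α) := fun r => {x | ∃ δ ∈ H, ∃ k : ℤ, k ≠ 0 ∧
    ∃ w ∈ alternatingProducts H (g ^ m) r, x = δ * (g ^ m) ^ k * w}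
  have hM : ∀ r, poincare norm s (M r) ≤
      S * Ω * poincare norm s (alternatingProducts H (g ^ m) r) :=
    fun r => poincare_alternating_step hs hC hmC r
  have hN : ∀ r, poincare norm s (alternatingProducts H (g ^ m) r) ≤ (S * Ω) ^ r * S := by
    intro r
    induction r with
    | zero => simp [alternatingProducts, hS]
    | succ r ih =>
      have hsub : alternatingProducts H (g ^ m) (r + 1) ⊆ M r := by
        rintro x ⟨δ, hδ, -, k, hk, w, hw, rfl⟩
        exact ⟨δ, hδ, k, hk, w, hw, rfl⟩
      calc _ ≤ poincare norm s (M r) := poincare_mono hsub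
        _ ≤ _ := hM r
        _ ≤ S * Ω * ((S * Ω) ^ r * S) := by gcongr
        _ = _ := by ring
  have hH' : ((H ⊔ Subgroup.zpowers (g ^ m) : Subgroup (FreeGroup α)) : Set (FreeGroup α)) ⊆
      (H : Set (FreeGroup α)) ∪ ⋃ r, M r := by
    intro x hx
    rcases mem_sup_zpowers_imp hx with h | ⟨r, δ, hδ, k, hk, w, hw, rfl⟩
    · exact Or.inl h
    · exact Or.inr (Set.mem_iUnion.2 ⟨r, δ, hδ, k, hk, w, hw, rfl⟩)
  refine ⟨H ⊔ Subgroup.zpowers (g ^ m), le_sup_left,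
    hH.sup ⟨{g ^ m}, by simp [Subgroup.zpowers_eq_closure]⟩,
    ⟨m, hm0, (le_sup_right : _ ≤ H ⊔ _) (Subgroup.mem_zpowers _)⟩, ?_, ?_⟩
  · refine (poincare_mono hH').trans ((poincare_union_le _ _).trans ?_)
    gcongr
    calc poincare norm s (⋃ r, M r) ≤ ∑' r, poincare norm s (M r) := poincare_iUnion_le _
      _ ≤ ∑' r, S * Ω * S * (S * Ω) ^ r := by
        refine ENNReal.tsum_le_tsum fun r => (hM r).trans ?_
        calc _ ≤ S * Ω * ((S * Ω) ^ r * S) := by gcongr; exact hN r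
          _ = _ := by ring
      _ = S * Ω * S * (1 - S * Ω)⁻¹ := by rw [ENNReal.tsum_mul_left, ENNReal.tsum_geometric]
      _ ≤ S * (A * expWeight s m) * S * 2 := by
        gcongr
        rw [ENNReal.inv_le_iff_inv_le, ← ENNReal.one_sub_inv_two]
        exact tsub_le_tsub_left hSΩ 1
      _ = S * S * A * 2 * expWeight s m := by ring
      _ ≤ ε := m3
  · intro x hx hxR
    rcases hH' hx with h | h
    · exact h
    · exfalso
      obtain ⟨r, δ, hδ, k, hk, w, hw, rfl⟩ := Set.mem_iUnion.1 h
      have h1 := hmC k hk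
      have h2 := gromov_zpow_alternatingProducts_le hC hmC r w hw
      have h3 := hm k hk
      rw [← zpow_natCast, ← zpow_mul] at h1 h3 hxR
      have := (norm_le_norm_mul_zpow_mul hC hδ h1 h2).1
      omega

end FreeGroup

/-! ### Chabauty convergence and a criterion for boomerang subgroups. -/

section Chabauty

variable {G : Type*} [Group G]

theorem tendsto_chabauty_iff {ι : Type*} {l : Filter ι} {f : ι → Subgroup G} {H : Subgroup G} :
    Tendsto f l (𝓝 H) ↔ ∀ g : G, ∀ᶠ k in l, (g ∈ f k ↔ g ∈ H) := by
  rw [nhds_induced, tendsto_comap_iff, tendsto_pi_nhds]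
  refine forall_congr' fun g => ?_
  rw [nhds_discrete, tendsto_pure]
  simp [subgroupIndicator]

theorem mem_conjSubgroup {g x : G} {H : Subgroup G} :
    x ∈ conjSubgroup g H ↔ g⁻¹ * x * g ∈ H := by
  unfold conjSubgroup
  rw [Subgroup.mem_map]
  constructor
  · rintro ⟨y, hy, rfl⟩
    simpa [mul_assoc] using hy
  · intro h
    exact ⟨_, h, by simp [mul_assoc]⟩

theorem conjSubgroup_of_mem {g : G} {H : Subgroup G} (hg : g ∈ H) : conjSubgroup g H = H := by
  ext x
  rw [mem_conjSubgroup, Subgroup.mul_mem_cancel_right _ hg,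
    Subgroup.mul_mem_cancel_left _ (inv_mem hg)]

/-- Conjugation by an element of H fixes H, so the sequence of multiples of m gives a constant
sequence of conjugates. -/
theorem isBoomerang_of_pow_mem {H : Subgroup G} (h : ∀ g : G, ∃ m : ℕ, m ≠ 0 ∧ g ^ m ∈ H) :
    IsBoomerang H := by
  intro g
  obtain ⟨m, hm, hgm⟩ := h g
  refine ⟨fun k => m * k, tendsto_id.const_mul_atTop' (Nat.pos_of_ne_zero hm), ?_⟩
  have : (fun k => conjSubgroup (g ^ (m * k)) H) = fun _ => H := by
    funext k
    apply conjSubgroup_of_mem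
    rw [pow_mul]
    exact pow_mem hgm k
  rw [this]
  exact tendsto_const_nhds

end Chabauty

section PoincareMore

variable {β γ : Type*} {len : β → ℕ} {s : ℝ}

theorem le_poincare_of_injective {f : γ → β} (hf : Function.Injective f) {Z : Set β}
    (hZ : ∀ c, f c ∈ Z) : ∑' c, expWeight s (len (f c)) ≤ poincare len s Z :=
  ENNReal.tsum_comp_le_tsum_of_injective
    (f := fun c => (⟨f c, hZ c⟩ : Z)) (fun a b hab => hf (by simpa using hab))
    (fun z : Z => expWeight s (len z))

theorem poincare_image_of_injOn {len' : γ → ℕ} {f : β → γ} {Z : Set β} (hf : Set.InjOn f Z)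
    (hlen : ∀ z ∈ Z, len' (f z) = len z) :
    poincare len' s (f '' Z) = poincare len s Z := by
  unfold poincare
  rw [tsum_image (fun z => expWeight s (len' z)) hf]
  exact tsum_congr fun z => by rw [hlen z z.2]

theorem poincare_eq_tsum (Z : Set β) :
    poincare len s Z = ∑' m : ℕ, poincare len s {z ∈ Z | len z = m} := by
  unfold poincare
  rw [← (Equiv.sigmaFiberEquiv (fun z : Z => len z)).tsum_eq, ENNReal.tsum_sigma']
  refine tsum_congr fun m => ?_
  let e : {z : Z // len z = m} ≃ {z | z ∈ Z ∧ len z = m} :=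
    { toFun := fun z => ⟨z.1.1, z.1.2, z.2⟩
      invFun := fun z => ⟨⟨z.1, z.2.1⟩, z.2.2⟩
      left_inv := fun _ => rfl
      right_inv := fun _ => rfl }
  rw [← e.tsum_eq]
  rfl

/-- Each finite partial sum already lives in a single Z n. This passes the bound to the limit
subgroup. -/
theorem poincare_iUnion_le_of_monotone {Z : ℕ → Set β} (hZ : Monotone Z) {B : ℝ≥0∞}
    (hB : ∀ n, poincare len s (Z n) ≤ B) : poincare len s (⋃ n, Z n) ≤ B := by
  have hn : ∀ x, ∃ n, x ∈ ⋃ n, Z n → x ∈ Z n := by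
    intro x
    by_cases hx : x ∈ ⋃ n, Z n
    · obtain ⟨n, hn⟩ := Set.mem_iUnion.1 hx
      exact ⟨n, fun _ => hn⟩
    · exact ⟨0, fun h => absurd h hx⟩
  choose n hn using hn
  rw [poincare, tsum_subtype (⋃ n, Z n) (fun z => expWeight s (len z)),
    ENNReal.tsum_eq_iSup_sum]
  refine iSup_le fun t => le_trans ?_ (hB (t.sup n))
  rw [poincare, tsum_subtype (Z (t.sup n)) (fun z => expWeight s (len z))]
  refine le_trans (Finset.sum_le_sum fun x hx => ?_) (ENNReal.sum_le_tsum t)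
  by_cases hxZ : x ∈ ⋃ n, Z n
  · rw [Set.indicator_of_mem hxZ, Set.indicator_of_mem (hZ (Finset.le_sup hx) (hn x hxZ))]
  · rw [Set.indicator_of_notMem hxZ]
    exact zero_le

end PoincareMore

namespace FreeGroup

/-! ### The Poincaré series of the whole free group. -/

section Counting

variable {α : Type*} {s : ℝ}

/-- The inverse of a letter. -/
def letterInv (x : α × Bool) : α × Bool := (x.1, !x.2)

@[simp] theorem letterInv_letterInv (x : α × Bool) : letterInv (letterInv x) = x := by
  simp [letterInv]

theorem isReduced_cons_cons' {x y : α × Bool} {w : List (α × Bool)} :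
    IsReduced (x :: y :: w) ↔ y ≠ letterInv x ∧ IsReduced (y :: w) := by
  rw [isReduced_cons_cons]
  refine and_congr_left fun _ => ?_
  rcases x with ⟨x, b⟩
  rcases y with ⟨y, c⟩
  simp only [letterInv, ne_eq, Prod.mk.injEq, not_and]
  constructor
  · rintro h rfl
    simp [h rfl]
  · rintro h rfl
    have := h rfl
    revert this
    cases b <;> cases c <;> simp

theorem IsReduced.tail {x : α × Bool} {w : List (α × Bool)} (h : IsReduced (x :: w)) :
    IsReduced w := h.infix ⟨[x], [], by simp⟩

/-- The words of length `m` which can be appended to the letter `x` without cancellation. -/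
def extensions (x : α × Bool) (m : ℕ) : Set (List (α × Bool)) :=
  {w | IsReduced (x :: w) ∧ w.length = m}

theorem extensions_succ (x : α × Bool) (m : ℕ) : extensions x (m + 1) =
    Set.range fun p : (Σ y : {y // y ≠ letterInv x}, extensions y.1 m) => p.1.1 :: p.2.1 := by
  ext w
  constructor
  · rintro ⟨h1, h2⟩
    cases w with
    | nil => simp at h2
    | cons y w =>
      rw [isReduced_cons_cons'] at h1
      exact ⟨⟨⟨y, h1.1⟩, ⟨w, h1.2, by simpa using h2⟩⟩, rfl⟩
  · rintro ⟨⟨⟨y, hy⟩, ⟨w, h1, h2⟩⟩, rfl⟩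
    exact ⟨isReduced_cons_cons'.2 ⟨hy, h1⟩, by simp [h2]⟩

section Words

variable [DecidableEq α]

theorem poincare_eq_poincare_toWord (Z : Set (FreeGroup α)) :
    poincare norm s Z = poincare List.length s (toWord '' Z) :=
  (poincare_image_of_injOn toWord_injective.injOn fun _ _ => rfl).symm

theorem image_toWord_univ :
    (toWord : FreeGroup α → _) '' Set.univ = {w | IsReduced w} := by
  ext w
  constructor
  · rintro ⟨x, -, rfl⟩
    exact isReduced_toWord
  · intro h
    exact ⟨mk w, trivial, by rw [toWord_mk, h.reduce_eq]⟩

end Words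

variable [Fintype α]

theorem card_ne_letter [DecidableEq α] (x : α × Bool) :
    Fintype.card {y : α × Bool // y ≠ x} = 2 * Fintype.card α - 1 := by
  rw [Fintype.card_subtype_compl, Fintype.card_subtype_eq]
  simp [mul_comm]

theorem poincare_extensions (x : α × Bool) (m : ℕ) :
    poincare List.length s (extensions x m) =
      (((2 * Fintype.card α - 1 : ℕ) : ℝ≥0∞) * expWeight s 1) ^ m := by
  classical
  induction m generalizing x with
  | zero =>
    have : extensions x 0 = {[]} := by
      ext w
      simp only [extensions, Set.mem_ofPred_eq, Set.mem_singleton_iff, List.length_eq_zero_iff]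
      exact ⟨fun h => h.2, by rintro rfl; simp⟩
    rw [this, poincare, tsum_singleton ([] : List (α × Bool)) fun z => expWeight s z.length]
    simp [expWeight_zero]
  | succ m ih =>
    rw [extensions_succ, poincare, tsum_range (fun z => expWeight s (List.length z))]
    · rw [ENNReal.tsum_sigma']
      simp only [List.length_cons, expWeight_add, ENNReal.tsum_mul_right]
      simp only [poincare] at ih
      simp only [ih, tsum_fintype, Finset.sum_const, Finset.card_univ, card_ne_letter]
      rw [nsmul_eq_mul]
      ring
    · rintro ⟨⟨y, hy⟩, ⟨w, hw⟩⟩ ⟨⟨z, hz⟩, ⟨v, hv⟩⟩ h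
      simp only [List.cons.injEq] at h
      obtain ⟨rfl, rfl⟩ := h
      rfl

variable [DecidableEq α]

theorem poincare_univ_eq_top [Nonempty α]
    (h : s ≤ Real.log (2 * (Fintype.card α : ℝ) - 1)) :
    poincare norm s (Set.univ : Set (FreeGroup α)) = ∞ := by
  have hcard : 1 ≤ Fintype.card α := Fintype.card_pos
  have hcard' : (1 : ℝ) ≤ Fintype.card α := by exact_mod_cast hcard
  obtain ⟨a⟩ := ‹Nonempty α›
  rw [poincare_eq_poincare_toWord, image_toWord_univ, poincare_eq_tsum, eq_top_iff]
  have h1 : 1 ≤ ((2 * Fintype.card α - 1 : ℕ) : ℝ≥0∞) * expWeight s 1 := by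
    rw [expWeight, ← ENNReal.ofReal_natCast, ← ENNReal.ofReal_mul (by positivity),
      ENNReal.one_le_ofReal]
    have e : ((2 * Fintype.card α - 1 : ℕ) : ℝ) = 2 * (Fintype.card α : ℝ) - 1 := by
      rw [Nat.cast_sub (by omega)]
      simp
    rw [e]
    have h2 : Real.exp s ≤ 2 * (Fintype.card α : ℝ) - 1 := by
      rwa [← Real.le_log_iff_exp_le (by linarith)]
    have h3 : Real.exp s * Real.exp (-s * (1 : ℕ)) = 1 := by
      rw [← Real.exp_add]
      simp
    exact h3.symm.le.trans (by gcongr)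
  calc ∞ = ∑' _ : ℕ, (1 : ℝ≥0∞) := by simp
    _ ≤ _ := by
      refine ENNReal.tsum_le_tsum fun m => ?_
      refine le_trans (one_le_pow₀ h1 (n := m)) ?_
      rw [← poincare_extensions (a, true) m]
      exact poincare_mono fun w hw => ⟨hw.1.tail, hw.2⟩

theorem poincare_univ_ne_top (h : Real.log (2 * (Fintype.card α : ℝ) - 1) < s) [Nonempty α] :
    poincare norm s (Set.univ : Set (FreeGroup α)) ≠ ∞ := by
  have hcard : 1 ≤ Fintype.card α := Fintype.card_pos
  have hcard' : (1 : ℝ) ≤ Fintype.card α := by exact_mod_cast hcard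
  set q := ((2 * Fintype.card α - 1 : ℕ) : ℝ≥0∞) * expWeight s 1 with hq
  have h1 : q < 1 := by
    rw [hq, expWeight, ← ENNReal.ofReal_natCast, ← ENNReal.ofReal_mul (by positivity),
      ENNReal.ofReal_lt_one]
    have e : ((2 * Fintype.card α - 1 : ℕ) : ℝ) = 2 * (Fintype.card α : ℝ) - 1 := by
      rw [Nat.cast_sub (by omega)]
      simp
    rw [e]
    have h2 : 2 * (Fintype.card α : ℝ) - 1 < Real.exp s := by
      rwa [← Real.log_lt_iff_lt_exp (by linarith)]
    have h3 : Real.exp s * Real.exp (-s * (1 : ℕ)) = 1 := by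
      rw [← Real.exp_add]
      simp
    exact lt_of_lt_of_eq (by gcongr) h3
  rw [poincare_eq_poincare_toWord, image_toWord_univ]
  have hsub : {w : List (α × Bool) | IsReduced w} ⊆ {[]} ∪ ⋃ m : ℕ, Set.range
      fun p : (Σ y : α × Bool, extensions y m) => p.1 :: p.2.1 := by
    intro w hw
    cases w with
    | nil => exact Or.inl rfl
    | cons y w => exact Or.inr (Set.mem_iUnion.2 ⟨w.length, ⟨y, w, hw, rfl⟩, rfl⟩)
  refine ne_top_of_le_ne_top ?_ (poincare_mono hsub)
  refine ne_top_of_le_ne_top ?_ (poincare_union_le _ _)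
  refine ENNReal.add_ne_top.2 ⟨poincare_ne_top_of_finite (Set.finite_singleton _), ?_⟩
  refine ne_top_of_le_ne_top ?_ (poincare_iUnion_le _)
  refine ne_top_of_le_ne_top (b := ∑' m, (2 * Fintype.card α : ℝ≥0∞) * expWeight s 1 * q ^ m)
    ?_ ?_
  · rw [ENNReal.tsum_mul_left, ENNReal.tsum_geometric]
    have : (1 - q)⁻¹ ≠ ∞ := by
      rw [ENNReal.inv_ne_top]
      exact (tsub_pos_of_lt h1).ne'
    have := expWeight_ne_top s 1
    finiteness
  · refine ENNReal.tsum_le_tsum fun m => (poincare_range_le _).trans (le_of_eq ?_)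
    rw [ENNReal.tsum_sigma']
    simp only [List.length_cons, expWeight_add, ENNReal.tsum_mul_right]
    have := fun y : α × Bool => poincare_extensions (s := s) y m
    simp only [poincare] at this
    simp only [this, tsum_fintype, Finset.sum_const, Finset.card_univ, Fintype.card_prod,
      Fintype.card_bool]
    rw [← hq, nsmul_eq_mul]
    push_cast
    ring

end Counting

/-! ### Conjugates that avoid large balls. -/

section NonConfined

variable {α : Type*} [DecidableEq α]

/-- If v moves the axis of g away, the conjugate starts with all but boundedly many letters of g^n,
too long an overlap for an element of H. Otherwise a power of v is a nontrivial power of g, which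
the conjugation fixes and H does not contain. -/
theorem eventually_conj_pow_notMem [Finite α] {H : Subgroup (FreeGroup α)} (hH : H.FG)
    {g : FreeGroup α} (hgH : ∀ n : ℕ, n ≠ 0 → g ^ n ∉ H) {v : FreeGroup α} (hv : v ≠ 1) :
    ∀ᶠ n : ℕ in atTop, g ^ n * v * (g ^ n)⁻¹ ∉ H := by
  have hg1 : g ≠ 1 := by
    rintro rfl
    exact hgH 1 one_ne_zero (by simp)
  obtain ⟨τ, κ, hτ, hnorm⟩ := exists_norm_pow hg1
  obtain ⟨Q, hQ⟩ := exists_isQuasiconvex hH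
  obtain ⟨T, hT⟩ := exists_gromov_zpow_le hQ g hgH
  rcases gromov_zpow_le_or_common_power hg1 hv with ⟨C, hC⟩ | ⟨p, k, hk, h⟩
  · filter_upwards [eventually_gt_atTop (T + C)] with n hn hmem
    have h1 := gromov_mul_add (g ^ n) (v * (g ^ n)⁻¹)
    rw [← mul_assoc] at h1
    have h2 := hT n _ hmem
    have h3 := hC (-n) (-n)
    simp only [zpow_neg, zpow_natCast] at h2 h3
    have h4 := hnorm n (by omega)
    have h5 : n * 1 ≤ n * τ := Nat.mul_le_mul_left n hτ
    omega
  · refine Eventually.of_forall fun n hmem => ?_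
    have h1 := pow_mem hmem p
    rw [conj_pow] at h1
    rcases h with h | h
    · apply hgH k hk
      rw [h, ← pow_add, add_comm, pow_add] at h1
      simpa using h1
    · apply hgH k hk
      rw [h] at h1
      have h2 := inv_mem h1
      have e : (g ^ n * (g ^ k)⁻¹ * (g ^ n)⁻¹)⁻¹ = g ^ k := by
        have : g ^ n * g ^ k = g ^ k * g ^ n := by rw [← pow_add, ← pow_add, add_comm]
        simp only [mul_inv_rev, inv_inv]
        rw [← mul_assoc, this]
        simp
      rwa [e] at h2

theorem gromov_of_zpow_of_zpow {a b : α} (hab : a ≠ b) (n m : ℤ) :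
    gromov (of a ^ n) (of b ^ m) = 0 := by
  have hword : ∀ (a : α) (n : ℤ), ∀ x ∈ (of a ^ n).toWord, x.1 = a := by
    intro a n x hx
    obtain ⟨k, rfl | rfl⟩ := n.eq_nat_or_neg
    · rw [zpow_natCast, toWord_of_pow] at hx
      rw [List.eq_of_mem_replicate hx]
    · rw [zpow_neg, zpow_natCast, toWord_inv, toWord_of_pow] at hx
      simp only [invRev, List.map_replicate, List.reverse_replicate] at hx
      rw [List.eq_of_mem_replicate hx]
  by_contra h
  obtain ⟨h1, h2, h3⟩ := (le_commonPrefixLength_iff _ _ 1).1 (Nat.one_le_iff_ne_zero.2 h)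
  have h4 := hword a n
  have h5 := hword b m
  cases h6 : (of a ^ n).toWord with
  | nil => simp [h6] at h1
  | cons x l =>
    cases h7 : (of b ^ m).toWord with
    | nil => simp [h7] at h2
    | cons y l' =>
      rw [h6, h7] at h3
      simp only [List.take_succ_cons, List.take_zero, List.cons.injEq, and_true] at h3
      rw [h6] at h4
      rw [h7] at h5
      apply hab
      rw [← h4 x (by simp), ← h5 y (by simp), h3]

/-- Every element is a prefix of a conjugate of each power of some free generator. -/
theorem exists_isPrefix_conj_pow [Nontrivial α] (w : FreeGroup α) :
    ∃ a : α, ∀ m : ℕ, m ≠ 0 → IsPrefix w ((w * of a * w⁻¹) ^ m) := by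
  -- The first letter of w⁻¹ involves at most one generator, so one of two distinct generators
  -- avoids it.
  have ha : ∃ a : α, ∀ n : ℤ, gromov w⁻¹ (of a ^ n) = 0 := by
    obtain ⟨a, b, hab⟩ := exists_pair_ne α
    by_contra! hcon
    obtain ⟨n, hn⟩ := hcon a
    obtain ⟨m, hm⟩ := hcon b
    have h1 : 1 ≤ gromov (of a ^ n) (of b ^ m) :=
      le_gromov_trans (y := w⁻¹) (by rw [gromov_comm]; omega) (by omega)
    rw [gromov_of_zpow_of_zpow hab] at h1
    omega
  obtain ⟨a, ha⟩ := ha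
  refine ⟨a, fun m hm => ?_⟩
  have h1 := norm_mul_add (of a ^ m) w⁻¹
  have h2 := gromov_mul_add (of a ^ m) w⁻¹
  have h3 : gromov (of a ^ m)⁻¹ w⁻¹ = 0 := by
    rw [gromov_comm]
    simpa using ha (-m)
  have h4 : gromov w⁻¹ (of a ^ m * w⁻¹) = 0 := by
    by_contra h
    have : 1 ≤ gromov w⁻¹ (of a ^ m) :=
      le_gromov_trans (y := of a ^ m * w⁻¹) (by omega)
        (by rw [gromov_comm]; rw [norm_of_pow] at h2; omega)
    have := ha m
    rw [zpow_natCast] at this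
    omega
  have h5 := norm_mul_add w (of a ^ m * w⁻¹)
  rw [conj_pow]
  unfold IsPrefix
  have e : w⁻¹ * (w * of a ^ m * w⁻¹) = of a ^ m * w⁻¹ := by group
  rw [e, mul_assoc]
  omega

/-- The Poincaré series of a cobounded subgroup diverges whenever that of the whole group does. -/
theorem poincare_univ_ne_top_of_cobounded [Finite α] {H : Subgroup (FreeGroup α)} {s : ℝ}
    (hs : 0 < s) {R : ℕ} (hR : ∀ w, ∃ b, norm b ≤ R ∧ w * b⁻¹ ∈ H)
    (hW : poincare norm s (H : Set (FreeGroup α)) ≠ ∞) :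
    poincare norm s (Set.univ : Set (FreeGroup α)) ≠ ∞ := by
  have hfin := (finite_setOf_norm_le (α := α) R).fintype
  let f : H × {x : FreeGroup α | norm x ≤ R} → FreeGroup α := fun p => p.1 * p.2
  have hf : Set.univ ⊆ Set.range f := by
    intro w _
    obtain ⟨b, hb, hbH⟩ := hR w
    exact ⟨(⟨_, hbH⟩, ⟨b, hb⟩), by simp [f]⟩
  refine ne_top_of_le_ne_top ?_ ((poincare_mono hf).trans (poincare_range_le f))
  have hbound : ∑' c, expWeight s (norm (f c)) ≤
      ∑' c : H × {x : FreeGroup α | norm x ≤ R},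
        expWeight s (norm (c.1 : FreeGroup α)) * expWeight (-s) R := by
    refine ENNReal.tsum_le_tsum fun c => ?_
    obtain ⟨⟨h, hh⟩, ⟨b, hb⟩⟩ := c
    have h1 : norm h ≤ norm (h * b) + R := by
      have := norm_mul_le (h * b) b⁻¹
      rw [norm_inv_eq, mul_inv_cancel_right] at this
      have hb : norm b ≤ R := hb
      omega
    have h2 := expWeight_anti hs.le h1
    rw [expWeight_add] at h2
    calc expWeight s (norm (h * b))
        = expWeight s (norm (h * b)) * expWeight s R * expWeight (-s) R := by
          rw [mul_assoc, mul_comm (expWeight s R), expWeight_neg_mul, mul_one]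
      _ ≤ _ := by gcongr
  refine ne_top_of_le_ne_top ?_ hbound
  rw [ENNReal.tsum_prod']
  simp only [tsum_fintype, Finset.sum_const, nsmul_eq_mul, ENNReal.tsum_mul_left,
    ENNReal.tsum_mul_right]
  have h3 : ∑' c : H, expWeight s (norm (c : FreeGroup α)) ≠ ∞ := hW
  exact ENNReal.mul_ne_top (ENNReal.natCast_ne_top _)
    (ENNReal.mul_ne_top h3 (expWeight_ne_top (-s) R))

/-- If every element had a power in H, every w would lie on a geodesic to a point of H. By
quasiconvexity H would be cobounded, and the series of the whole group would converge at s ≤ L. -/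
theorem exists_pow_notMem [Fintype α] [Nontrivial α] {H : Subgroup (FreeGroup α)} (hH : H.FG)
    {s : ℝ} (hs : 0 < s) (hlog : s ≤ Real.log (2 * (Fintype.card α : ℝ) - 1))
    (hW : poincare norm s (H : Set (FreeGroup α)) ≠ ∞) :
    ∃ g : FreeGroup α, ∀ n : ℕ, n ≠ 0 → g ^ n ∉ H := by
  by_contra! hcon
  obtain ⟨R, hR⟩ := exists_isQuasiconvex hH
  refine poincare_univ_ne_top_of_cobounded hs (R := R) (fun w => ?_) hW (poincare_univ_eq_top hlog)
  obtain ⟨a, ha⟩ := exists_isPrefix_conj_pow w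
  obtain ⟨n, hn, hnH⟩ := hcon (w * of a * w⁻¹)
  exact hR _ hnH w (ha n hn)

theorem exists_conj_avoiding_ball [Fintype α] [Nontrivial α] {H : Subgroup (FreeGroup α)}
    (hH : H.FG) {s : ℝ} (hs : 0 < s) (hlog : s ≤ Real.log (2 * (Fintype.card α : ℝ) - 1))
    (hW : poincare norm s (H : Set (FreeGroup α)) ≠ ∞) (R : ℕ) :
    ∃ h : FreeGroup α, ∀ v, norm v ≤ R → v ≠ 1 → h⁻¹ * v * h ∉ H := by
  obtain ⟨g, hg⟩ := exists_pow_notMem hH hs hlog hW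
  have h1 : ∀ᶠ n : ℕ in atTop, ∀ v ∈ {v : FreeGroup α | norm v ≤ R}, v ≠ 1 →
      g ^ n * v * (g ^ n)⁻¹ ∉ H := by
    rw [(finite_setOf_norm_le R).eventually_all]
    intro v _
    by_cases hv : v = 1
    · exact Eventually.of_forall fun _ h => absurd hv h
    · filter_upwards [eventually_conj_pow_notMem hH hg hv] with n hn _ using hn
  obtain ⟨n, hn⟩ := h1.exists
  exact ⟨(g ^ n)⁻¹, fun v hv hv1 => by simpa using hn v hv hv1⟩

end NonConfined

/-! ### Non-confined boomerang subgroups as increasing unions. -/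

/-- A finitely generated subgroup with convergent Poincaré series at `s` is contained in a
non-confined boomerang subgroup with the same property. -/
theorem exists_boomerang_of_fg {α : Type*} [DecidableEq α] [Fintype α] [Nontrivial α]
    {H : Subgroup (FreeGroup α)} (hH : H.FG) {s : ℝ} (hs : 0 < s)
    (hlog : s ≤ Real.log (2 * (Fintype.card α : ℝ) - 1))
    (hW : poincare norm s (H : Set (FreeGroup α)) ≠ ∞) :
    ∃ K : Subgroup (FreeGroup α), H ≤ K ∧ IsBoomerang K ∧ ¬ IsConfined K ∧
      poincare norm s (K : Set (FreeGroup α)) ≠ ∞ := by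
  obtain ⟨e, he⟩ := exists_surjective_nat (FreeGroup α)
  -- The number is the radius of a ball in which later stages may not gain elements.
  let State := {p : Subgroup (FreeGroup α) × ℕ //
    p.1.FG ∧ poincare norm s (p.1 : Set (FreeGroup α)) ≠ ∞}
  have step : ∀ (n : ℕ) (p : State), ∃ q : State, p.1.1 ≤ q.1.1 ∧
      (∃ m : ℕ, m ≠ 0 ∧ e n ^ m ∈ q.1.1) ∧
      poincare norm s (q.1.1 : Set (FreeGroup α)) ≤
        poincare norm s (p.1.1 : Set (FreeGroup α)) + 2⁻¹ ^ n ∧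
      (∀ x ∈ q.1.1, norm x ≤ p.1.2 → x ∈ p.1.1) ∧ p.1.2 ≤ q.1.2 ∧
      ∃ h : FreeGroup α, ∀ v, norm v ≤ n → v ≠ 1 →
        norm (h⁻¹ * v * h) ≤ q.1.2 ∧ h⁻¹ * v * h ∉ q.1.1 := by
    rintro n ⟨⟨K, R⟩, hK, hKW⟩
    obtain ⟨K', h1, h2, h3, h4, h5⟩ := exists_adjoin_pow hK hs hKW (e n) R
      (ε := 2⁻¹ ^ n) (by simp)
    have h6 : poincare norm s (K' : Set (FreeGroup α)) ≠ ∞ :=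
      ne_top_of_le_ne_top (ENNReal.add_ne_top.2 ⟨hKW, by finiteness⟩) h4
    obtain ⟨h, hh⟩ := exists_conj_avoiding_ball h2 hs hlog h6 n
    -- The radius n + 2|h| covers the conjugates by h⁻¹ of the ball of radius n, so their absence
    -- from K' is preserved forever.
    refine ⟨⟨⟨K', max R (n + 2 * norm h)⟩, h2, h6⟩, h1, h3, h4, h5, le_max_left _ _, h,
      fun v hv hv1 => ⟨le_max_of_le_right ?_, hh v hv hv1⟩⟩
    have a1 := norm_mul_le (h⁻¹ * v) h
    have a2 := norm_mul_le h⁻¹ v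
    rw [norm_inv_eq] at a2
    omega
  choose F hF using step
  let p : ℕ → State := fun n => Nat.rec ⟨(H, 0), hH, hW⟩ (fun n q => F n q) n
  have hp : ∀ n, p (n + 1) = F n (p n) := fun n => rfl
  have hmono : Monotone fun n => (p n).1.1 :=
    monotone_nat_of_le_succ fun n => (hF n (p n)).1
  have hRmono : Monotone fun n => (p n).1.2 :=
    monotone_nat_of_le_succ fun n => (hF n (p n)).2.2.2.2.1
  have hmem : ∀ {x}, x ∈ (⨆ n, (p n).1.1) ↔ ∃ n, x ∈ (p n).1.1 :=
    Subgroup.mem_iSup_of_directed hmono.directed_le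
  have hstab : ∀ n m, n ≤ m → ∀ x ∈ (p m).1.1, norm x ≤ (p n).1.2 → x ∈ (p n).1.1 := by
    intro n m hnm
    induction m, hnm using Nat.le_induction with
    | base => exact fun x hx _ => hx
    | succ m hnm ih =>
      intro x hx hxn
      exact ih x ((hF m (p m)).2.2.2.1 x hx (hxn.trans (hRmono hnm))) hxn
  refine ⟨⨆ n, (p n).1.1, le_iSup (fun n => (p n).1.1) 0, ?_, ?_, ?_⟩
  · refine isBoomerang_of_pow_mem fun g => ?_
    obtain ⟨n, rfl⟩ := he g
    obtain ⟨m, hm, h⟩ := (hF n (p n)).2.1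
    exact ⟨m, hm, hmem.2 ⟨n + 1, h⟩⟩
  · rw [IsConfined, not_not]
    have := fun n => (hF n (p n)).2.2.2.2.2
    choose h hh using this
    refine ⟨h, tendsto_chabauty_iff.2 fun v => ?_⟩
    by_cases hv : v = 1
    · exact Eventually.of_forall fun n => by simp [hv, one_mem]
    · filter_upwards [eventually_ge_atTop (norm v)] with n hn
      simp only [Subgroup.mem_bot, hv, iff_false, mem_conjSubgroup, hmem]
      rintro ⟨m, hm⟩
      obtain ⟨h1, h2⟩ := hh n v hn hv
      rcases le_total (n + 1) m with hnm | hnm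
      · exact h2 (hstab _ _ hnm _ hm h1)
      · exact h2 (hmono hnm hm)
  · have hset : ((⨆ n, (p n).1.1 : Subgroup (FreeGroup α)) : Set (FreeGroup α)) =
        ⋃ n, ((p n).1.1 : Set (FreeGroup α)) := by
      ext x
      simp [hmem]
    rw [hset]
    refine ne_top_of_le_ne_top (b := poincare norm s (H : Set (FreeGroup α)) + 2)
      (by finiteness) (poincare_iUnion_le_of_monotone hmono fun n => ?_)
    have h1 : ∀ n, poincare norm s ((p n).1.1 : Set (FreeGroup α)) ≤
        poincare norm s (H : Set (FreeGroup α)) + ∑ i ∈ Finset.range n, 2⁻¹ ^ i := by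
      intro n
      induction n with
      | zero => simp [p]
      | succ n ih =>
        rw [Finset.sum_range_succ, ← add_assoc]
        exact ((hF n (p n)).2.2.1).trans (by gcongr)
    refine (h1 n).trans ?_
    gcongr
    refine (ENNReal.sum_le_tsum _).trans (le_of_eq ?_)
    rw [ENNReal.tsum_geometric, ENNReal.one_sub_inv_two, inv_inv]

end FreeGroup

theorem poincare_mul_poincare {β γ : Type*} {len : β → ℕ} {len' : γ → ℕ} {s : ℝ} (A : Set β)
    (B : Set γ) : poincare len s A * poincare len' s B =
      ∑' p : A × B, expWeight s (len p.1 + len' p.2) := by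
  simp only [poincare, expWeight_add]
  rw [ENNReal.tsum_prod', ← ENNReal.tsum_mul_right]
  exact tsum_congr fun a => ENNReal.tsum_mul_left.symm

namespace FreeGroup

/-! ### Weights of reduced paths in a subgraph of a Cayley graph. -/

section Paths

variable {α : Type*} {G : Type*} [Group G] (φ : FreeGroup α →* G)

/-- The word `w` labels a path starting at `q` and using only edges in `E`, in the right Cayley
graph of `G` with respect to the images of the generators. -/
def IsPath (E : Set (G × (α × Bool))) : G → List (α × Bool) → Prop
  | _, [] => True
  | q, x :: w => (q, x) ∈ E ∧ IsPath E (q * φ (mk [x])) w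

/-- The set of edges is invariant under reversal of edges. -/
def IsSymmEdgeSet (E : Set (G × (α × Bool))) : Prop :=
  ∀ q x, (q, x) ∈ E → (q * φ (mk [x]), letterInv x) ∈ E

/-- The reduced words labelling paths from `q` to `q'` with edges in `E`. -/
def pathSet (E : Set (G × (α × Bool))) (q q' : G) : Set (List (α × Bool)) :=
  {w | IsReduced w ∧ IsPath φ E q w ∧ q * φ (mk w) = q'}

variable {φ} {E E' : Set (G × (α × Bool))} {q q' : G}

theorem map_mk_cons (x : α × Bool) (w : List (α × Bool)) :
    φ (mk (x :: w)) = φ (mk [x]) * φ (mk w) := by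
  rw [← _root_.map_mul, mul_mk, List.singleton_append]

theorem map_mk_append (v w : List (α × Bool)) :
    φ (mk (v ++ w)) = φ (mk v) * φ (mk w) := by
  rw [← _root_.map_mul, mul_mk]

theorem mk_letterInv (x : α × Bool) : mk [letterInv x] = (mk [x])⁻¹ := by
  rw [inv_mk]
  simp [invRev, letterInv]

theorem map_mk_letterInv (x : α × Bool) : φ (mk [letterInv x]) = (φ (mk [x]))⁻¹ := by
  rw [mk_letterInv, _root_.map_inv]

theorem isPath_append {v w : List (α × Bool)} :
    IsPath φ E q (v ++ w) ↔ IsPath φ E q v ∧ IsPath φ E (q * φ (mk v)) w := by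
  induction v generalizing q with
  | nil => simp [IsPath, ← one_eq_mk]
  | cons x v ih =>
    rw [List.cons_append, IsPath, ih, IsPath, map_mk_cons x v, mul_assoc, and_assoc]

theorem IsPath.invRev (hE : IsSymmEdgeSet φ E) {w : List (α × Bool)} (hw : IsPath φ E q w) :
    IsPath φ E (q * φ (mk w)) (invRev w) := by
  induction w generalizing q with
  | nil => trivial
  | cons x w ih =>
    rw [invRev_cons, isPath_append]
    refine ⟨?_, ?_⟩
    · have := ih hw.2
      rwa [mul_assoc, ← map_mk_cons] at this
    · rw [← inv_mk, _root_.map_inv, map_mk_cons x w, ← mul_assoc, mul_inv_cancel_right]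
      exact ⟨hE q x hw.1, trivial⟩

theorem IsPath.of_red {v w : List (α × Bool)} (hv : IsPath φ E q v) (h : Red v w) :
    IsPath φ E q w := by
  induction h with
  | refl => exact hv
  | tail _ h ih =>
    cases h with
    | @not L₁ L₂ x b =>
      rw [isPath_append] at ih ⊢
      refine ⟨ih.1, ?_⟩
      have h2 := ih.2.2.2
      have e : φ (mk [(x, !b)]) = (φ (mk [(x, b)]))⁻¹ := map_mk_letterInv (x, b)
      rwa [e, mul_inv_cancel_right] at h2

theorem isPath_or_exists_split {w : List (α × Bool)} (hw : IsPath φ E' q w) :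
    IsPath φ E q w ∨ ∃ w₀ y w₁, w = w₀ ++ y :: w₁ ∧ IsPath φ E q w₀ ∧
      (q * φ (mk w₀), y) ∈ E' \ E ∧ IsPath φ E' (q * φ (mk w₀) * φ (mk [y])) w₁ := by
  induction w generalizing q with
  | nil => exact Or.inl trivial
  | cons x w ih =>
    by_cases hx : (q, x) ∈ E
    · rcases ih hw.2 with h | ⟨w₀, y, w₁, rfl, h0, h1, h2⟩
      · exact Or.inl ⟨hx, h⟩
      · refine Or.inr ⟨x :: w₀, y, w₁, rfl, ⟨hx, h0⟩, ?_, ?_⟩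
        · rwa [map_mk_cons x w₀, ← mul_assoc]
        · rwa [map_mk_cons x w₀, ← mul_assoc]
    · refine Or.inr ⟨[], x, w, rfl, trivial, ?_, ?_⟩
      · simpa [← one_eq_mk] using ⟨hw.1, hx⟩
      · simpa [← one_eq_mk] using hw.2

theorem isReduced_append_iff {v w : List (α × Bool)} : IsReduced (v ++ w) ↔
    IsReduced v ∧ IsReduced w ∧ ∀ x ∈ v.getLast?, ∀ y ∈ w.head?, y ≠ letterInv x := by
  unfold IsReduced
  rw [List.isChain_append]
  refine and_congr_right fun _ => and_congr_right fun _ => ?_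
  refine forall₂_congr fun x _ => forall₂_congr fun y _ => ?_
  have := @isReduced_cons_cons' α x y []
  rw [isReduced_cons_cons] at this
  simpa using this

theorem isReduced_cons_iff {x : α × Bool} {w : List (α × Bool)} : IsReduced (x :: w) ↔
    IsReduced w ∧ ∀ y ∈ w.head?, y ≠ letterInv x := by
  have := @isReduced_append_iff α [x] w
  simpa using this

theorem isReduced_concat_iff {x : α × Bool} {w : List (α × Bool)} : IsReduced (w ++ [x]) ↔
    IsReduced w ∧ ∀ y ∈ w.getLast?, x ≠ letterInv y := by
  simpa using @isReduced_append_iff α w [x]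

theorem letterInv_ne_self (x : α × Bool) : letterInv x ≠ x := by
  rcases x with ⟨a, b⟩
  cases b <;> simp [letterInv]

variable {s : ℝ}

/-- Closed cyclically reduced paths with prescribed first and last letters grow at most at the
critical rate. -/
theorem poincare_cyclic_lt_one (hgood : poincare List.length s (pathSet φ E q q) ≠ ∞)
    {x y : α × Bool} (hxy : x ≠ letterInv y) {m : ℕ} (hm : m ≠ 0) :
    poincare List.length s {w | w ∈ pathSet φ E q q ∧ w.head? = some x ∧
      w.getLast? = some y ∧ w.length = m} < 1 := by
  set a : ℕ → ℝ≥0∞ := fun m => poincare List.length s {w | w ∈ pathSet φ E q q ∧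
    w.head? = some x ∧ w.getLast? = some y ∧ w.length = m} with ha
  -- The condition on end letters lets loops be concatenated without cancellation. By
  -- supermultiplicativity, one value at least 1 would recur along all multiples and contradict
  -- summability.
  have hmul : ∀ m n, a m * a n ≤ a (m + n) := by
    intro m n
    simp only [ha]
    rw [poincare_mul_poincare]
    set A := {w | w ∈ pathSet φ E q q ∧
      w.head? = some x ∧ w.getLast? = some y ∧ w.length = m}
    set B := {w | w ∈ pathSet φ E q q ∧
      w.head? = some x ∧ w.getLast? = some y ∧ w.length = n}
    refine le_trans (le_of_eq (tsum_congr fun p => ?_))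
      (le_poincare_of_injective (f := fun p : A × B => p.1.1 ++ p.2.1) ?_ ?_)
    · rw [List.length_append]
    · rintro ⟨⟨v, hv⟩, ⟨w, hw⟩⟩ ⟨⟨v', hv'⟩, ⟨w', hw'⟩⟩ h
      have := List.append_inj h (hv.2.2.2.trans hv'.2.2.2.symm)
      simp only [Prod.mk.injEq, Subtype.mk.injEq]
      exact this
    · rintro ⟨⟨v, hv⟩, ⟨w, hw⟩⟩
      change v ++ w ∈ _
      obtain ⟨⟨hv1, hv2, hv3⟩, hv4, hv5, hv6⟩ := hv
      obtain ⟨⟨hw1, hw2, hw3⟩, hw4, hw5, hw6⟩ := hw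
      refine ⟨⟨?_, ?_, ?_⟩, ?_, ?_, ?_⟩
      · rw [isReduced_append_iff]
        refine ⟨hv1, hw1, ?_⟩
        simp only [hv5, hw4, Option.mem_def, Option.some.injEq]
        rintro _ rfl _ rfl
        exact hxy
      · rw [isPath_append, hv3]
        exact ⟨hv2, hw2⟩
      · rw [map_mk_append, ← mul_assoc, hv3, hw3]
      · simp [hv4]
      · simp [hw5]
      · simp [hv6, hw6]
  by_contra! hlt
  have hpow : ∀ k, 1 ≤ a (m * (k + 1)) := by
    intro k
    induction k with
    | zero => rwa [zero_add, mul_one]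
    | succ k ih =>
      calc (1 : ℝ≥0∞) = 1 * 1 := by simp
        _ ≤ a (m * (k + 1)) * a m := mul_le_mul' ih hlt
        _ ≤ _ := hmul _ _
  have hsum : ∑' m, a m ≠ ∞ := by
    refine ne_top_of_le_ne_top hgood ?_
    rw [poincare_eq_tsum]
    exact ENNReal.tsum_le_tsum fun m => poincare_mono fun w hw => ⟨hw.1, hw.2.2.2⟩
  have ht := ENNReal.tendsto_atTop_zero_of_tsum_ne_top hsum
  obtain ⟨N, hN⟩ := eventually_atTop.1 (ht.eventually (gt_mem_nhds one_pos))
  have h1 : N ≤ m * (N + 1) := by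
    have : 1 * (N + 1) ≤ m * (N + 1) := Nat.mul_le_mul_right _ (Nat.pos_of_ne_zero hm)
    omega
  exact absurd (hN _ h1) (not_lt.2 (hpow N))

variable [Fintype α]

theorem poincare_iUnion_letter_le {x : α × Bool} {Z : (α × Bool) → Set (List (α × Bool))}
    {B : ℝ≥0∞} (hZ : ∀ y, poincare List.length s (Z y) ≤ expWeight s 2 * B)
    (hs : ((2 * Fintype.card α - 1 : ℕ) : ℝ≥0∞) * expWeight s 2 ≤ 1) :
    poincare List.length s (⋃ y : {y : α × Bool // y ≠ x}, Z y.1) ≤ B := by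
  classical
  refine (poincare_iUnion_le _).trans ?_
  rw [tsum_fintype]
  refine (Finset.sum_le_sum fun y _ => hZ y.1).trans ?_
  rw [Finset.sum_const, Finset.card_univ, card_ne_letter, nsmul_eq_mul, ← mul_assoc]
  exact mul_le_of_le_one_left' hs

/-- A loop is either cyclically reduced, which contributes at most one unit for each pair of end
letters, or of the form y v y⁻¹ with v a loop at the neighbouring vertex. Forbidding x⁻¹ as first
letter leaves 2d-1 choices of y, each of weight e^(-2s), with total at most 1 by `hs`; so the bound
grows by a constant when m grows by 2. -/
theorem poincare_closed_after_le
    (hs : ((2 * Fintype.card α - 1 : ℕ) : ℝ≥0∞) * expWeight s 2 ≤ 1)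
    (hgood : ∀ q, poincare List.length s (pathSet φ E q q) ≠ ∞) (m : ℕ) :
    ∀ (x : α × Bool) (q : G), poincare List.length s
      {w | w ∈ pathSet φ E q q ∧ IsReduced (x :: w) ∧ w.length = m} ≤
      ((Fintype.card (α × Bool) ^ 2 * (m + 1) : ℕ) : ℝ≥0∞) := by
  induction m using Nat.strong_induction_on with
  | _ m ih =>
  intro x q
  set K := Fintype.card (α × Bool) ^ 2 with hK
  have hK1 : 1 ≤ K := Nat.one_le_pow _ _ (Fintype.card_pos_iff.2 ⟨x⟩)
  rcases Nat.eq_zero_or_pos m with rfl | hm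
  · have hsub : {w | w ∈ pathSet φ E q q ∧ IsReduced (x :: w) ∧ w.length = 0} ⊆ {[]} :=
      fun w hw => List.length_eq_zero_iff.1 hw.2.2
    refine (poincare_mono hsub).trans ?_
    rw [poincare, tsum_singleton ([] : List (α × Bool)) fun z => expWeight s z.length]
    simp only [List.length_nil, expWeight_zero]
    exact_mod_cast hK1.trans (by simp)
  · let Z : α × Bool → Set (List (α × Bool)) := fun y =>
      Set.range fun v : {v | 2 ≤ m ∧ v ∈ pathSet φ E (q * φ (mk [y])) (q * φ (mk [y])) ∧
        IsReduced (y :: v) ∧ v.length = m - 2} => y :: (v.1 ++ [letterInv y])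
    have hsub : {w | w ∈ pathSet φ E q q ∧ IsReduced (x :: w) ∧ w.length = m} ⊆
        (⋃ p : {p : (α × Bool) × (α × Bool) // p.1 ≠ letterInv p.2},
          {w | w ∈ pathSet φ E q q ∧ w.head? = some p.1.1 ∧
            w.getLast? = some p.1.2 ∧ w.length = m}) ∪
        ⋃ y : {y : α × Bool // y ≠ letterInv x}, Z y.1 := by
      rintro w ⟨hw, hxw, hwm⟩
      obtain ⟨y, u, rfl⟩ := List.exists_cons_of_length_pos (by omega : 0 < w.length)
      rcases List.eq_nil_or_concat u with rfl | ⟨v, z, rfl⟩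
      · exact Or.inl (Set.mem_iUnion.2
          ⟨⟨(y, y), (letterInv_ne_self y).symm⟩, hw, rfl, rfl, hwm⟩)
      · rw [List.concat_eq_append] at hw hxw hwm ⊢
        by_cases hyz : y = letterInv z
        · right
          refine Set.mem_iUnion.2 ⟨⟨y, (isReduced_cons_cons'.1 hxw).1⟩, ?_⟩
          have hz : z = letterInv y := by simp [hyz]
          subst hz
          obtain ⟨h1, h2, h3⟩ := hw
          refine ⟨⟨v, ?_, ⟨?_, ?_, ?_⟩, ?_, ?_⟩, rfl⟩
          · simp at hwm; omega
          · exact h1.infix ⟨[y], [letterInv y], by simp⟩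
          · exact (isPath_append.1 h2.2).1
          · rw [map_mk_cons y, map_mk_append, map_mk_letterInv] at h3
            have h4 : φ (mk [y]) * φ (mk v) = φ (mk [y]) := by
              rw [mul_eq_left, ← mul_assoc, mul_inv_eq_one] at h3
              exact h3
            rw [mul_assoc, h4]
          · exact h1.infix ⟨[], [letterInv y], by simp⟩
          · simp at hwm; omega
        · left
          refine Set.mem_iUnion.2 ⟨⟨(y, z), hyz⟩, hw, rfl, ?_, hwm⟩
          rw [← List.cons_append, List.getLast?_concat]
    refine (poincare_mono hsub).trans ((poincare_union_le _ _).trans ?_)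
    have hB1 : poincare List.length s
        (⋃ p : {p : (α × Bool) × (α × Bool) // p.1 ≠ letterInv p.2},
          {w | w ∈ pathSet φ E q q ∧ w.head? = some p.1.1 ∧
            w.getLast? = some p.1.2 ∧ w.length = m}) ≤ (K : ℝ≥0∞) := by
      classical
      refine (poincare_iUnion_le _).trans ?_
      rw [tsum_fintype]
      refine (Finset.sum_le_sum fun p _ =>
        (poincare_cyclic_lt_one (hgood q) p.2 hm.ne').le).trans ?_
      rw [Finset.sum_const, Finset.card_univ, nsmul_eq_mul, mul_one, Nat.cast_le, hK, pow_two,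
        ← Fintype.card_prod]
      exact Fintype.card_subtype_le _
    have hB2 : poincare List.length s (⋃ y : {y : α × Bool // y ≠ letterInv x}, Z y.1) ≤
        ((K * (m - 1) : ℕ) : ℝ≥0∞) := by
      refine poincare_iUnion_letter_le (fun y => ?_) hs
      refine (poincare_range_le _).trans ?_
      have e : ∀ v : List (α × Bool), (y :: (v ++ [letterInv y])).length = 2 + v.length := by
        intro v
        simp
        omega
      simp only [e, expWeight_add, ENNReal.tsum_mul_left]
      gcongr
      by_cases h2 : 2 ≤ m
      · have := ih (m - 2) (by omega) y (q * φ (mk [y]))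
        rw [show m - 2 + 1 = m - 1 by omega] at this
        refine le_trans (poincare_mono (len := List.length) fun v hv => ?_) this
        exact hv.2
      · have : IsEmpty {v | 2 ≤ m ∧ v ∈ pathSet φ E (q * φ (mk [y])) (q * φ (mk [y])) ∧
          IsReduced (y :: v) ∧ v.length = m - 2} := ⟨fun v => h2 v.2.1⟩
        rw [tsum_empty]
        exact zero_le
    refine (add_le_add hB1 hB2).trans ?_
    rw [← Nat.cast_add, Nat.cast_le]
    calc K + K * (m - 1) = K * (1 + (m - 1)) := by ring
      _ ≤ K * (m + 1) := Nat.mul_le_mul_left _ (by omega)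

/-- Every reduced word can be preceded by a or by a⁻¹ without cancellation; hence the factor 2. -/
theorem poincare_closed_le [Nonempty α]
    (hs : ((2 * Fintype.card α - 1 : ℕ) : ℝ≥0∞) * expWeight s 2 ≤ 1)
    (hgood : ∀ q, poincare List.length s (pathSet φ E q q) ≠ ∞) (m : ℕ) (q : G) :
    poincare List.length s {w | w ∈ pathSet φ E q q ∧ w.length = m} ≤
      ((2 * Fintype.card (α × Bool) ^ 2 * (m + 1) : ℕ) : ℝ≥0∞) := by
  obtain ⟨a⟩ := ‹Nonempty α›
  have hsub : {w | w ∈ pathSet φ E q q ∧ w.length = m} ⊆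
      {w | w ∈ pathSet φ E q q ∧ IsReduced ((a, true) :: w) ∧ w.length = m} ∪
      {w | w ∈ pathSet φ E q q ∧ IsReduced (letterInv (a, true) :: w) ∧ w.length = m} := by
    rintro w ⟨hw, hwm⟩
    by_cases h : IsReduced ((a, true) :: w)
    · exact Or.inl ⟨hw, h, hwm⟩
    · refine Or.inr ⟨hw, ?_, hwm⟩
      rw [isReduced_cons_iff] at h ⊢
      refine ⟨hw.1, fun y hy hya => h ⟨hw.1, fun z hz hza => ?_⟩⟩
      rw [Option.mem_unique hy hz, hza, letterInv_letterInv] at hya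
      exact letterInv_ne_self _ hya
  refine (poincare_mono hsub).trans ((poincare_union_le _ _).trans ?_)
  refine (add_le_add (poincare_closed_after_le hs hgood m _ q)
    (poincare_closed_after_le hs hgood m _ q)).trans ?_
  rw [← Nat.cast_add, Nat.cast_le]
  apply le_of_eq
  ring

/-- If two paths end with different letters, the first followed by the reverse of the second is a
reduced loop of length 2m. If they end with the same letter, strip it: again 2d-1 choices of weight
e^(-2s). The bounds 2K(2m+1) add up to 2K(m+1)², as odd numbers sum to squares. -/
theorem poincare_pairs_le [Nonempty α] (hE : IsSymmEdgeSet φ E)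
    (hs : ((2 * Fintype.card α - 1 : ℕ) : ℝ≥0∞) * expWeight s 2 ≤ 1)
    (hgood : ∀ q, poincare List.length s (pathSet φ E q q) ≠ ∞) (q : G) (m : ℕ) :
    ∀ (y : α × Bool) (q' : G),
      poincare (fun p : List (α × Bool) × List (α × Bool) => p.1.length + p.2.length) s
      {p | (p.1 ∈ pathSet φ E q q' ∧ IsReduced (p.1 ++ [y]) ∧ p.1.length = m) ∧
        p.2 ∈ pathSet φ E q q' ∧ IsReduced (p.2 ++ [y]) ∧ p.2.length = m} ≤
      ((2 * Fintype.card (α × Bool) ^ 2 * (m + 1) ^ 2 : ℕ) : ℝ≥0∞) := by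
  set K := Fintype.card (α × Bool) ^ 2 with hK
  have hdiff : ∀ (m : ℕ) (q' : G),
      poincare (fun p : List (α × Bool) × List (α × Bool) => p.1.length + p.2.length) s
      {p | (p.1 ∈ pathSet φ E q q' ∧ p.1.length = m) ∧ (p.2 ∈ pathSet φ E q q' ∧ p.2.length = m) ∧
        ∀ x ∈ p.1.getLast?, ∀ z ∈ p.2.getLast?, x ≠ z} ≤
      ((2 * K * (2 * m + 1) : ℕ) : ℝ≥0∞) := by
    intro m q'
    refine le_trans ?_ (poincare_closed_le hs hgood (2 * m) q)
    rw [← poincare_image_of_injOn (len' := List.length)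
      (f := fun p : List (α × Bool) × List (α × Bool) => p.1 ++ invRev p.2)]
    · apply poincare_mono
      rintro _ ⟨⟨v, w⟩, ⟨⟨⟨hv1, hv2, hv3⟩, hv4⟩, ⟨⟨hw1, hw2, hw3⟩, hw4⟩, hvw⟩, rfl⟩
      refine ⟨⟨?_, ?_, ?_⟩, ?_⟩
      · classical
        rw [isReduced_append_iff]
        refine ⟨hv1, hw1.invRev, fun x hx z hz hzx => ?_⟩
        simp only [invRev, List.head?_reverse, List.getLast?_map, Option.mem_def,
          Option.map_eq_some_iff] at hz
        obtain ⟨z', hz', rfl⟩ := hz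
        apply hvw x hx z' hz'
        rw [← letterInv_letterInv x, ← hzx]
        simp [letterInv]
      · rw [isPath_append, hv3]
        refine ⟨hv2, ?_⟩
        have := hw2.invRev hE
        rwa [hw3] at this
      · rw [map_mk_append, ← mul_assoc, hv3, ← inv_mk, _root_.map_inv, ← hw3, mul_inv_cancel_right]
      · simp [hv4, hw4]
        omega
    · rintro ⟨v, w⟩ ⟨⟨-, hv⟩, -⟩ ⟨v', w'⟩ ⟨⟨-, hv'⟩, -⟩ h
      have := List.append_inj h (hv.trans hv'.symm)
      rw [Prod.mk.injEq]
      exact ⟨this.1, invRev_injective this.2⟩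
    · rintro ⟨v, w⟩ -
      simp
  induction m with
  | zero =>
    intro y q'
    refine le_trans (poincare_mono ?_) ((hdiff 0 q').trans (by simp))
    rintro ⟨v, w⟩ ⟨⟨hv1, hv2, hv3⟩, hw1, hw2, hw3⟩
    refine ⟨⟨hv1, hv3⟩, ⟨hw1, hw3⟩, ?_⟩
    have : v = [] := List.length_eq_zero_iff.1 hv3
    simp [this]
  | succ m ih =>
    intro y q'
    let Z : α × Bool → Set (List (α × Bool) × List (α × Bool)) := fun z =>
      Set.range fun p : {p : List (α × Bool) × List (α × Bool) |
        (p.1 ∈ pathSet φ E q (q' * (φ (mk [z]))⁻¹) ∧ IsReduced (p.1 ++ [z]) ∧ p.1.length = m) ∧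
        p.2 ∈ pathSet φ E q (q' * (φ (mk [z]))⁻¹) ∧ IsReduced (p.2 ++ [z]) ∧ p.2.length = m} =>
        (p.1.1 ++ [z], p.1.2 ++ [z])
    have hsub : {p : List (α × Bool) × List (α × Bool) |
        (p.1 ∈ pathSet φ E q q' ∧ IsReduced (p.1 ++ [y]) ∧ p.1.length = m + 1) ∧
        p.2 ∈ pathSet φ E q q' ∧ IsReduced (p.2 ++ [y]) ∧ p.2.length = m + 1} ⊆
        {p | (p.1 ∈ pathSet φ E q q' ∧ p.1.length = m + 1) ∧
          (p.2 ∈ pathSet φ E q q' ∧ p.2.length = m + 1) ∧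
          ∀ x ∈ p.1.getLast?, ∀ z ∈ p.2.getLast?, x ≠ z} ∪
        ⋃ z : {z : α × Bool // z ≠ letterInv y}, Z z.1 := by
      rintro ⟨v, w⟩ ⟨⟨hv1, hv2, hv3⟩, hw1, hw2, hw3⟩
      rcases List.eq_nil_or_concat v with rfl | ⟨v, x, rfl⟩
      · simp at hv3
      rcases List.eq_nil_or_concat w with rfl | ⟨w, z, rfl⟩
      · simp at hw3
      simp only [List.concat_eq_append] at *
      by_cases hxz : x = z
      · subst hxz
        right
        have key : ∀ {v : List (α × Bool)}, v ++ [x] ∈ pathSet φ E q q' →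
            (v ++ [x]).length = m + 1 → v ∈ pathSet φ E q (q' * (φ (mk [x]))⁻¹) ∧
            IsReduced (v ++ [x]) ∧ v.length = m := by
          rintro v ⟨h1, h2, h3⟩ h4
          refine ⟨⟨h1.infix ⟨[], [x], by simp⟩, (isPath_append.1 h2).1, ?_⟩, h1, by simpa using h4⟩
          rw [← h3, map_mk_append, ← mul_assoc, mul_inv_cancel_right]
        refine Set.mem_iUnion.2 ⟨⟨x, ?_⟩, ⟨⟨(v, w), key hv1 hv3, key hw1 hw3⟩, rfl⟩⟩
        have := (isReduced_concat_iff.1 hv2).2 x (by simp)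
        intro hxy
        rw [hxy, letterInv_letterInv] at this
        exact this rfl
      · left
        exact ⟨⟨hv1, hv3⟩, ⟨hw1, hw3⟩, by simpa using hxz⟩
    refine (poincare_mono hsub).trans ((poincare_union_le _ _).trans ?_)
    have hB : poincare (fun p : List (α × Bool) × List (α × Bool) => p.1.length + p.2.length) s
        (⋃ z : {z : α × Bool // z ≠ letterInv y}, Z z.1) ≤
        ((2 * K * (m + 1) ^ 2 : ℕ) : ℝ≥0∞) := by
      classical
      refine (poincare_iUnion_le _).trans ?_
      rw [tsum_fintype]
      have hZ : ∀ z, poincare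
          (fun p : List (α × Bool) × List (α × Bool) => p.1.length + p.2.length) s (Z z) ≤
          expWeight s 2 * ((2 * K * (m + 1) ^ 2 : ℕ) : ℝ≥0∞) := by
        intro z
        refine (poincare_range_le _).trans ?_
        have e : ∀ v w : List (α × Bool), (v ++ [z]).length + (w ++ [z]).length =
            2 + (v.length + w.length) := by
          intro v w
          simp
          omega
        simp only [e, expWeight_add, ENNReal.tsum_mul_left]
        gcongr
        have := ih z (q' * (φ (mk [z]))⁻¹)
        simpa only [poincare, expWeight_add] using this
      refine (Finset.sum_le_sum fun z _ => hZ z.1).trans ?_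
      rw [Finset.sum_const, Finset.card_univ, card_ne_letter, nsmul_eq_mul, ← mul_assoc]
      exact mul_le_of_le_one_left' hs
    refine (add_le_add (hdiff (m + 1) q') hB).trans ?_
    rw [← Nat.cast_add, Nat.cast_le]
    apply le_of_eq
    ring

/-- The square of the weight of paths is the weight of pairs, so the bound on pairs yields one
linear in m. It does not depend on the graph. -/
theorem poincare_paths_le [Nonempty α] (hE : IsSymmEdgeSet φ E)
    (hs : ((2 * Fintype.card α - 1 : ℕ) : ℝ≥0∞) * expWeight s 2 ≤ 1)
    (hgood : ∀ q, poincare List.length s (pathSet φ E q q) ≠ ∞) (q q' : G) (m : ℕ) :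
    poincare List.length s {w | w ∈ pathSet φ E q q' ∧ w.length = m} ≤
      ((4 * Fintype.card (α × Bool) ^ 2 * (m + 1) : ℕ) : ℝ≥0∞) := by
  set K := Fintype.card (α × Bool) ^ 2 with hK
  have hK1 : 1 ≤ K := Nat.one_le_pow _ _ Fintype.card_pos
  have key : ∀ y : α × Bool, poincare List.length s
      {w | w ∈ pathSet φ E q q' ∧ IsReduced (w ++ [y]) ∧ w.length = m} ≤
      ((2 * K * (m + 1) : ℕ) : ℝ≥0∞) := by
    intro y
    have h1 := poincare_pairs_le hE hs hgood q m y q'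
    have h2 := poincare_mul_poincare (len := List.length) (len' := List.length) (s := s)
      {w | w ∈ pathSet φ E q q' ∧ IsReduced (w ++ [y]) ∧ w.length = m}
      {w | w ∈ pathSet φ E q q' ∧ IsReduced (w ++ [y]) ∧ w.length = m}
    set A := {w | w ∈ pathSet φ E q q' ∧ IsReduced (w ++ [y]) ∧ w.length = m} with hA
    have h3 : poincare List.length s A * poincare List.length s A ≤
        ((2 * K * (m + 1) ^ 2 : ℕ) : ℝ≥0∞) := by
      rw [h2]
      refine le_trans ?_ h1
      refine le_poincare_of_injective
        (len := fun p : List (α × Bool) × List (α × Bool) => p.1.length + p.2.length)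
        (f := fun p : A × A => (p.1.1, p.2.1)) ?_ ?_
      · rintro ⟨⟨v, hv⟩, ⟨w, hw⟩⟩ ⟨⟨v', hv'⟩, ⟨w', hw'⟩⟩ h
        simpa using h
      · rintro ⟨⟨v, hv⟩, ⟨w, hw⟩⟩
        exact ⟨hv, hw⟩
    by_contra! hlt
    have h4 := ENNReal.mul_lt_mul hlt hlt
    refine absurd (h4.trans_le h3) (not_lt.2 ?_)
    rw [← Nat.cast_mul, Nat.cast_le]
    nlinarith [Nat.mul_le_mul_right ((m + 1) ^ 2 * (2 * K)) (show 1 ≤ 2 * K by omega)]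
  obtain ⟨a⟩ := ‹Nonempty α›
  have hsub : {w | w ∈ pathSet φ E q q' ∧ w.length = m} ⊆
      {w | w ∈ pathSet φ E q q' ∧ IsReduced (w ++ [(a, true)]) ∧ w.length = m} ∪
      {w | w ∈ pathSet φ E q q' ∧ IsReduced (w ++ [letterInv (a, true)]) ∧ w.length = m} := by
    rintro w ⟨hw, hwm⟩
    by_cases h : IsReduced (w ++ [(a, true)])
    · exact Or.inl ⟨hw, h, hwm⟩
    · refine Or.inr ⟨hw, ?_, hwm⟩
      rw [isReduced_concat_iff] at h ⊢
      refine ⟨hw.1, fun y hy hya => h ⟨hw.1, fun z hz hza => ?_⟩⟩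
      rw [Option.mem_unique hy hz, ← hza] at hya
      exact letterInv_ne_self _ hya
  refine (poincare_mono hsub).trans ((poincare_union_le _ _).trans ?_)
  refine (add_le_add (key _) (key _)).trans ?_
  rw [← Nat.cast_add, Nat.cast_le]
  apply le_of_eq
  ring

end Paths

end FreeGroup

theorem expWeight_split (s t : ℝ) (n : ℕ) :
    expWeight t n = expWeight (t - s) n * expWeight s n := by
  rw [expWeight, expWeight, expWeight, ← ENNReal.ofReal_mul (Real.exp_pos _).le, ← Real.exp_add]
  congr 2
  ring

theorem tsum_natCast_mul_expWeight_ne_top {s : ℝ} (hs : 0 < s) (K : ℕ) :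
    ∑' m : ℕ, ((K * (m + 1) : ℕ) : ℝ≥0∞) * expWeight s m ≠ ∞ := by
  have h1 : ∀ m : ℕ, ((K * (m + 1) : ℕ) : ℝ≥0∞) * expWeight s m =
      ENNReal.ofReal ((K * (m + 1)) * Real.exp (-s) ^ m) := by
    intro m
    rw [expWeight, ← ENNReal.ofReal_natCast, ← ENNReal.ofReal_mul (by positivity)]
    congr 1
    rw [← Real.exp_nat_mul, mul_comm (m : ℝ) (-s)]
    push_cast
    rfl
  simp only [h1]
  have hr : ‖Real.exp (-s)‖ < 1 := by
    rw [Real.norm_of_nonneg (Real.exp_pos _).le, Real.exp_lt_one_iff]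
    linarith
  have h2 : Summable fun m : ℕ => (K * (m + 1)) * Real.exp (-s) ^ m := by
    have a1 := summable_pow_mul_geometric_of_norm_lt_one 1 hr
    have a2 := summable_pow_mul_geometric_of_norm_lt_one 0 hr
    refine ((a1.add a2).mul_left (K : ℝ)).congr fun m => ?_
    simp only [pow_one, pow_zero]
    ring
  rw [← ENNReal.ofReal_tsum_of_nonneg (fun m => by positivity) h2]
  exact ENNReal.ofReal_ne_top

namespace FreeGroup

/-! ### Adding one edge to a graph of large girth. -/

section AddEdge

variable {α : Type*} {G : Type*} [Group G] {φ : FreeGroup α →* G}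
  {E : Set (G × (α × Bool))}

variable (φ) in
/-- The edge `e` traversed backwards. -/
def reverseEdge (e : G × (α × Bool)) : G × (α × Bool) :=
  (e.1 * φ (mk [e.2]), letterInv e.2)

theorem reverseEdge_reverseEdge (e : G × (α × Bool)) :
    reverseEdge φ (reverseEdge φ e) = e := by
  simp only [reverseEdge, map_mk_letterInv, mul_inv_cancel_right, letterInv_letterInv]

theorem IsSymmEdgeSet.union_edge (hE : IsSymmEdgeSet φ E) (e : G × (α × Bool)) :
    IsSymmEdgeSet φ (E ∪ {e, reverseEdge φ e}) := by
  rintro q x (h | h | h)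
  · exact Or.inl (hE q x h)
  · subst h
    exact Or.inr (Or.inr rfl)
  · right
    left
    rw [← reverseEdge_reverseEdge (φ := φ) e, ← h]
    rfl

variable {t : ℝ}

theorem poincare_image2_append_le (A B : Set (List (α × Bool))) (y : α × Bool) (ht : 0 ≤ t) :
    poincare List.length t (Set.range fun p : A × B => p.1.1 ++ y :: p.2.1) ≤
      poincare List.length t A * poincare List.length t B := by
  rw [poincare_mul_poincare]
  refine (poincare_range_le _).trans (ENNReal.tsum_le_tsum fun p => expWeight_anti ht ?_)
  simp

/-- The words labelling paths from the endpoint of `e`, of length at most `L`, which do not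
backtrack along `e`. -/
def continuations (φ : FreeGroup α →* G) (E : Set (G × (α × Bool))) (e : G × (α × Bool)) (q : G)
    (L : ℕ) : Set (List (α × Bool)) :=
  {w | w ∈ pathSet φ E (e.1 * φ (mk [e.2])) q ∧ IsReduced (e.2 :: w) ∧ w.length ≤ L}

/-- Cut at the next passage through the added edge, in either direction; large girth forces the
piece before it to be long. -/
theorem continuations_subset (n : ℕ) (hker : ∀ w : List (α × Bool), IsReduced w → w ≠ [] →
      φ (mk w) = 1 → n < w.length) (e : G × (α × Bool)) {f : G × (α × Bool)}
      (hf : f = e ∨ f = reverseEdge φ e) (q : G) (L : ℕ) :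
    continuations φ (E ∪ {e, reverseEdge φ e}) f q L ⊆
      pathSet φ E (f.1 * φ (mk [f.2])) q ∪ ⋃ c : Bool,
        Set.range fun p : {w | w ∈ pathSet φ E (f.1 * φ (mk [f.2]))
          (bif c then e else reverseEdge φ e).1 ∧ n ≤ w.length} ×
          continuations φ (E ∪ {e, reverseEdge φ e}) (bif c then e else reverseEdge φ e) q (L - 1) =>
        p.1.1 ++ (bif c then e else reverseEdge φ e).2 :: p.2.1 := by
  rintro w ⟨⟨hw1, hw2, hw3⟩, hw4, hw5⟩
  rcases isPath_or_exists_split (E := E) hw2 with h | ⟨w₀, y, w₁, rfl, h0, h1, h2⟩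
  · exact Or.inl ⟨hw1, h, hw3⟩
  right
  have hc : ∃ c : Bool, (f.1 * φ (mk [f.2]) * φ (mk w₀), y) =
      bif c then e else reverseEdge φ e := by
    rcases h1 with ⟨h | h | h, h'⟩
    · exact absurd h h'
    · exact ⟨true, h⟩
    · exact ⟨false, h⟩
  obtain ⟨c, hc⟩ := hc
  set f' := bif c then e else reverseEdge φ e with hf'
  have hred0 : IsReduced (f.2 :: w₀) := hw4.infix ⟨[], y :: w₁, by simp⟩
  have hred1 : IsReduced (y :: w₁) := hw4.infix ⟨f.2 :: w₀, [], by simp⟩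
  have hy : f'.2 = y := by rw [← hc]
  have hq : f'.1 = f.1 * φ (mk [f.2]) * φ (mk w₀) := by rw [← hc]
  have hn : n ≤ w₀.length := by
    -- In the same direction, f followed by `w₀` is a reduced cycle. In the opposite direction `w₀`
    -- itself is one, and it is nonempty because the path does not backtrack.
    have hff : f' = f ∨ f' = reverseEdge φ f := by
      rcases hf with rfl | rfl <;> cases c <;> simp [hf', reverseEdge_reverseEdge]
    rcases hff with h | h
    · have := hker (f.2 :: w₀) hred0 (by simp) (by
        rw [map_mk_cons]
        rw [h, mul_assoc] at hq
        exact (mul_eq_left.1 hq.symm))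
      simpa [Nat.lt_succ_iff] using this
    · have hw0 : w₀ ≠ [] := by
        rintro rfl
        rw [List.nil_append] at hw4
        apply (isReduced_cons_cons'.1 hw4).1
        rw [← hy, h]
        rfl
      refine (hker w₀ hred0.tail hw0 ?_).le
      rw [h] at hq
      exact mul_eq_left.1 hq.symm
  refine Set.mem_iUnion.2 ⟨c, ⟨⟨⟨w₀, ⟨hred0.tail, h0, hq.symm⟩, hn⟩, ⟨w₁, ?_⟩⟩, ?_⟩⟩
  · refine ⟨⟨hred1.tail, ?_, ?_⟩, ?_, ?_⟩
    · rwa [hq, hy]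
    · rw [hq, hy, mul_assoc, ← map_mk_cons, mul_assoc, ← map_mk_append, hw3]
    · rwa [hy]
    · simp at hw5
      omega
  · change w₀ ++ f'.2 :: w₁ = _
    rw [hy]

/-- Cutting gives B + 2 · (1/4) · 2B = 2B. The truncation at length L makes this an induction, with
no finiteness assumed beforehand. -/
theorem poincare_continuations_le (ht : 0 ≤ t) {n : ℕ} (hker : ∀ w : List (α × Bool),
      IsReduced w → w ≠ [] → φ (mk w) = 1 → n < w.length) {B : ℝ≥0∞}
    (hB : ∀ q q', poincare List.length t (pathSet φ E q q') ≤ B)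
    (htail : ∀ q q', poincare List.length t {w | w ∈ pathSet φ E q q' ∧ n ≤ w.length} ≤ 4⁻¹)
    (e : G × (α × Bool)) (q : G) (L : ℕ) :
    ∀ c : Bool, poincare List.length t (continuations φ (E ∪ {e, reverseEdge φ e})
      (bif c then e else reverseEdge φ e) q L) ≤ 2 * B := by
  have h4 : (4 : ℝ≥0∞)⁻¹ * 2 + 4⁻¹ * 2 = 1 := by
    rw [← mul_add, show (2 : ℝ≥0∞) + 2 = 4 by norm_num]
    exact ENNReal.inv_mul_cancel (by norm_num) (by norm_num)
  induction L with
  | zero =>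
    intro c
    refine (poincare_mono ?_).trans ((hB ((bif c then e else reverseEdge φ e).1 *
      φ (mk [(bif c then e else reverseEdge φ e).2])) q).trans
      (le_mul_of_one_le_left' one_le_two))
    rintro w ⟨⟨hw1, hw2, hw3⟩, hw4, hw5⟩
    have : w = [] := List.length_eq_zero_iff.1 (by omega)
    subst this
    exact ⟨hw1, trivial, hw3⟩
  | succ L ih =>
    intro c
    refine (poincare_mono (continuations_subset n hker e (by cases c <;> simp) q (L + 1))).trans
      ((poincare_union_le _ _).trans ?_)
    have h1 : poincare List.length t (⋃ c' : Bool,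
        Set.range fun p : {w | w ∈ pathSet φ E ((bif c then e else reverseEdge φ e).1 *
          φ (mk [(bif c then e else reverseEdge φ e).2]))
          (bif c' then e else reverseEdge φ e).1 ∧ n ≤ w.length} ×
          continuations φ (E ∪ {e, reverseEdge φ e}) (bif c' then e else reverseEdge φ e) q
            (L + 1 - 1) =>
        p.1.1 ++ (bif c' then e else reverseEdge φ e).2 :: p.2.1) ≤ B := by
      refine (poincare_iUnion_le _).trans ?_
      rw [tsum_fintype]
      refine (Finset.sum_le_sum fun c' _ => (poincare_image2_append_le _ _ _ ht).trans
        (mul_le_mul' (htail _ _) (ih c'))).trans ?_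
      rw [Fintype.sum_bool, ← mul_assoc, ← add_mul, h4, one_mul]
    exact (add_le_add (hB _ _) h1).trans (le_of_eq (two_mul B).symm)

/-- Adding an edge keeps the Poincaré series convergent, if the long paths have small weight and
there are no short cycles. -/
theorem poincare_union_edge_ne_top (ht : 0 ≤ t) {n : ℕ} (hker : ∀ w : List (α × Bool),
      IsReduced w → w ≠ [] → φ (mk w) = 1 → n < w.length) {B : ℝ≥0∞} (hBtop : B ≠ ∞)
    (hB : ∀ q q', poincare List.length t (pathSet φ E q q') ≤ B)
    (htail : ∀ q q', poincare List.length t {w | w ∈ pathSet φ E q q' ∧ n ≤ w.length} ≤ 4⁻¹)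
    (e : G × (α × Bool)) (q q' : G) :
    poincare List.length t (pathSet φ (E ∪ {e, reverseEdge φ e}) q q') ≠ ∞ := by
  let A : Bool → Set (List (α × Bool)) := fun c => ⋃ L, continuations φ (E ∪ {e, reverseEdge φ e})
    (bif c then e else reverseEdge φ e) q' L
  have hA : ∀ c, poincare List.length t (A c) ≤ 2 * B := fun c =>
    poincare_iUnion_le_of_monotone
      (Z := fun L => continuations φ (E ∪ {e, reverseEdge φ e})
        (bif c then e else reverseEdge φ e) q' L)
      (fun L L' hL w hw => ⟨hw.1, hw.2.1, hw.2.2.trans hL⟩)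
      (fun L => poincare_continuations_le ht hker hB htail e q' L c)
  have hsub : pathSet φ (E ∪ {e, reverseEdge φ e}) q q' ⊆ pathSet φ E q q' ∪
      ⋃ c : Bool, Set.range fun p : pathSet φ E q (bif c then e else reverseEdge φ e).1 × A c =>
        p.1.1 ++ (bif c then e else reverseEdge φ e).2 :: p.2.1 := by
    rintro w ⟨hw1, hw2, hw3⟩
    rcases isPath_or_exists_split (E := E) hw2 with h | ⟨w₀, y, w₁, rfl, h0, h1, h2⟩
    · exact Or.inl ⟨hw1, h, hw3⟩
    right
    have hc : ∃ c : Bool, (q * φ (mk w₀), y) = bif c then e else reverseEdge φ e := by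
      rcases h1 with ⟨h | h | h, h'⟩
      · exact absurd h h'
      · exact ⟨true, h⟩
      · exact ⟨false, h⟩
    obtain ⟨c, hc⟩ := hc
    have hred0 : IsReduced w₀ := hw1.infix ⟨[], y :: w₁, by simp⟩
    have hred1 : IsReduced (y :: w₁) := hw1.infix ⟨w₀, [], by simp⟩
    refine Set.mem_iUnion.2 ⟨c, ⟨⟨⟨w₀, hred0, h0, by rw [← hc]⟩,
      ⟨w₁, Set.mem_iUnion.2 ⟨w₁.length, ?_⟩⟩⟩, ?_⟩⟩
    · rw [← hc]
      refine ⟨⟨hred1.tail, h2, ?_⟩, hred1, le_rfl⟩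
      rw [mul_assoc, ← map_mk_cons, mul_assoc, ← map_mk_append, hw3]
    · change w₀ ++ (bif c then e else reverseEdge φ e).2 :: w₁ = _
      rw [← hc]
  refine ne_top_of_le_ne_top ?_ ((poincare_mono hsub).trans (poincare_union_le _ _))
  refine ENNReal.add_ne_top.2 ⟨ne_top_of_le_ne_top hBtop (hB _ _), ?_⟩
  refine ne_top_of_le_ne_top ?_ (poincare_iUnion_le _)
  rw [tsum_fintype]
  refine ENNReal.sum_ne_top.2 fun c _ => ?_
  refine ne_top_of_le_ne_top ?_ ((poincare_image2_append_le _ _ _ ht).trans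
    (mul_le_mul' (hB _ _) (hA c)))
  finiteness

end AddEdge

/-! ### Finite quotients of large girth. -/

section FiniteQuotient

universe u

/-- Left multiplication by a generator is a partial injection of the ball of radius n and extends to
a permutation of it. A word of length at most n then carries 1 to the element it represents. -/
theorem exists_finite_quotient {α : Type u} [DecidableEq α] [Finite α] (n : ℕ) :
    ∃ (ι : Type u) (_ : Finite ι) (φ : FreeGroup α →* Equiv.Perm ι),
      ∀ w : List (α × Bool), IsReduced w → w ≠ [] → φ (mk w) = 1 → n < w.length := by
  classical
  let ι := {x : FreeGroup α // norm x ≤ n}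
  have hfin : Finite ι := finite_setOf_norm_le n
  have := Fintype.ofFinite ι
  let e : ∀ a : α, {x : ι // norm (of a * x.1) ≤ n} ≃ {x : ι // norm ((of a)⁻¹ * x.1) ≤ n} :=
    fun a =>
    { toFun := fun x => ⟨⟨of a * x.1.1, x.2⟩, by simpa using x.1.2⟩
      invFun := fun x => ⟨⟨(of a)⁻¹ * x.1.1, x.2⟩, by simpa using x.1.2⟩
      left_inv := fun x => by simp
      right_inv := fun x => by simp }
  let σ : α → Equiv.Perm ι := fun a => (e a).extendSubtype
  let φ : FreeGroup α →* Equiv.Perm ι := lift σ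
  have hσ : ∀ (a : α) (x : ι) (h : norm (of a * x.1) ≤ n), σ a x = ⟨of a * x.1, h⟩ := by
    intro a x h
    exact (e a).extendSubtype_apply_of_mem x h
  have key : ∀ w : List (α × Bool), w.length ≤ n →
      (φ (mk w) ⟨1, by simp⟩ : ι).1 = mk w := by
    intro w hw
    induction w with
    | nil => rw [← one_eq_mk, _root_.map_one]; rfl
    | cons x w ih =>
      have hw' : w.length ≤ n := by simp at hw; omega
      have ih := ih hw'
      have hnorm : norm (mk (x :: w)) ≤ n := norm_mk_le.trans hw
      have hcons : mk (x :: w) = mk [x] * mk w := by rw [mul_mk, List.singleton_append]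
      rw [map_mk_cons, Equiv.Perm.mul_apply]
      set z := φ (mk w) ⟨1, by simp⟩ with hz
      rcases x with ⟨a, b⟩
      cases b with
      | true =>
        have e1 : φ (mk [(a, true)]) = σ a := lift_apply_of
        have h0 : norm (of a * z.1) ≤ n := by
          rw [ih]
          rw [hcons] at hnorm
          exact hnorm
        rw [e1, hσ a z h0]
        change of a * z.1 = _
        rw [ih, hcons]
        rfl
      | false =>
        have e0 : mk [(a, false)] = (of a)⁻¹ := rfl
        have e1 : φ (mk [(a, false)]) = (σ a)⁻¹ := by
          rw [e0, _root_.map_inv]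
          congr 1
        have hin : σ a ⟨mk ((a, false) :: w), hnorm⟩ = z := by
          have h2 : of a * mk ((a, false) :: w) = mk w := by rw [hcons, e0, mul_inv_cancel_left]
          rw [hσ a _ (by rw [h2]; exact norm_mk_le.trans hw')]
          apply Subtype.ext
          rw [ih]
          exact h2
        rw [e1, ← hin]
        simp
  refine ⟨ι, hfin, φ, fun w hw hne h1 => ?_⟩
  by_contra! hle
  have := key w hle
  rw [h1] at this
  have h2 := congrArg norm this
  rw [norm_mk_of_isReduced hw] at h2
  simp only [Equiv.Perm.coe_one, id_eq, norm_one] at h2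
  exact hne (List.length_eq_zero_iff.1 h2.symm)

end FiniteQuotient

/-! ### Loop groups of finite graphs. -/

section LoopSubgroup

variable {α : Type*} [DecidableEq α]

/-- Follow the geodesic to δ letter by letter, staying R-close to points of H; consecutive points
differ by an element of H of length at most 2R + 1. -/
theorem IsQuasiconvex.fg [Finite α] {H : Subgroup (FreeGroup α)} {R : ℕ}
    (hH : IsQuasiconvex H R) : H.FG := by
  let T : Set (FreeGroup α) := {x | x ∈ H ∧ norm x ≤ 2 * R + 1}
  have hT : T.Finite := (finite_setOf_norm_le (2 * R + 1)).subset fun x hx => hx.2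
  rw [Subgroup.fg_iff]
  refine ⟨T, le_antisymm ((Subgroup.closure_le _).2 fun x hx => hx.1) fun δ hδ => ?_, hT⟩
  have key : ∀ l : List (α × Bool), l <+: δ.toWord →
      ∃ b, norm b ≤ R ∧ mk l * b⁻¹ ∈ Subgroup.closure T := by
    intro l
    induction l using List.reverseRecOn with
    | nil => exact fun _ => ⟨1, by simp, by rw [← one_eq_mk]; simp⟩
    | append_singleton l x ih =>
      intro hl
      obtain ⟨b, hb, hbT⟩ := ih ((List.prefix_append l [x]).trans hl)
      obtain ⟨m, hm⟩ := hl
      have hpre : IsPrefix (mk (l ++ [x])) δ := by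
        have := isPrefix_mk_of_append (l := l ++ [x]) (m := m) (by rw [hm]; exact isReduced_toWord)
        rwa [hm, mk_toWord] at this
      obtain ⟨b', hb', hbH⟩ := hH δ hδ _ hpre
      refine ⟨b', hb', ?_⟩
      have hle : Subgroup.closure T ≤ H := (Subgroup.closure_le _).2 fun x hx => hx.1
      have e : (mk l * b⁻¹)⁻¹ * (mk (l ++ [x]) * b'⁻¹) = b * mk [x] * b'⁻¹ := by
        rw [← mul_mk]
        group
      have hmem : b * mk [x] * b'⁻¹ ∈ T := by
        refine ⟨?_, ?_⟩
        · rw [← e]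
          exact mul_mem (inv_mem (hle hbT)) hbH
        · have a1 := norm_mul_le (b * mk [x]) b'⁻¹
          have a2 := norm_mul_le b (mk [x])
          have a3 : norm (mk [x]) ≤ 1 := norm_mk_le
          rw [norm_inv_eq] at a1
          omega
      have := mul_mem hbT (Subgroup.subset_closure hmem)
      rw [← e, mul_inv_cancel_left] at this
      exact this
  obtain ⟨b, hb, hbT⟩ := key δ.toWord List.prefix_rfl
  rw [mk_toWord] at hbT
  have hbmem : b ∈ T := by
    refine ⟨?_, by omega⟩
    have h1 : δ * b⁻¹ ∈ H := (Subgroup.closure_le _).2 (fun x hx => hx.1) hbT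
    have := mul_mem (inv_mem h1) hδ
    simpa using this
  have := mul_mem hbT (Subgroup.subset_closure hbmem)
  simpa using this

variable {G : Type*} [Group G] {φ : FreeGroup α →* G} {E : Set (G × (α × Bool))}

theorem IsPath.toWord_mul {q : G} {x y : FreeGroup α} (hx : IsPath φ E q x.toWord)
    (hy : IsPath φ E (q * φ x) y.toWord) : IsPath φ E q (x * y).toWord := by
  rw [FreeGroup.toWord_mul]
  refine IsPath.of_red (isPath_append.2 ⟨hx, ?_⟩) reduce.red
  rwa [mk_toWord]

theorem IsPath.toWord_inv (hE : IsSymmEdgeSet φ E) {q : G} {x : FreeGroup α}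
    (hx : IsPath φ E q x.toWord) : IsPath φ E (q * φ x) x⁻¹.toWord := by
  rw [FreeGroup.toWord_inv]
  have := hx.invRev hE
  rwa [mk_toWord] at this

/-- The subgroup of the elements whose reduced word labels a closed path at `q`. -/
def loopSubgroup (hE : IsSymmEdgeSet φ E) (q : G) : Subgroup (FreeGroup α) where
  carrier := {x | IsPath φ E q x.toWord ∧ φ x = 1}
  one_mem' := ⟨by rw [toWord_one]; trivial, _root_.map_one φ⟩
  mul_mem' := by
    rintro x y ⟨hx, hx1⟩ ⟨hy, hy1⟩
    exact ⟨hx.toWord_mul (by rwa [hx1, mul_one]), by rw [_root_.map_mul, hx1, hy1, mul_one]⟩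
  inv_mem' := by
    rintro x ⟨hx, hx1⟩
    refine ⟨?_, by rw [_root_.map_inv, hx1, inv_one]⟩
    have := hx.toWord_inv hE
    rwa [hx1, mul_one] at this

theorem poincare_loopSubgroup (hE : IsSymmEdgeSet φ E) (q : G) (s : ℝ) :
    poincare norm s (loopSubgroup hE q : Set (FreeGroup α)) =
      poincare List.length s (pathSet φ E q q) := by
  rw [poincare_eq_poincare_toWord]
  congr 1
  ext w
  constructor
  · rintro ⟨x, ⟨hx, hx1⟩, rfl⟩
    exact ⟨isReduced_toWord, hx, by rw [mk_toWord, hx1, mul_one]⟩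
  · rintro ⟨h1, h2, h3⟩
    have hw : (mk w).toWord = w := by rw [toWord_mk, h1.reduce_eq]
    exact ⟨mk w, ⟨by rwa [hw], by simpa using h3⟩, hw⟩

theorem IsPrefix.exists_toWord_eq_append {p x : FreeGroup α} (h : IsPrefix p x) :
    ∃ l, x.toWord = p.toWord ++ l := by
  have h1 := isPrefix_iff_gromov.1 h
  obtain ⟨-, -, h2⟩ := (le_commonPrefixLength_iff _ _ _).1 h1
  refine ⟨x.toWord.drop (norm p), ?_⟩
  rw [norm, List.take_length] at h2
  conv_lhs => rw [← List.take_append_drop (norm p) x.toWord]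
  rw [norm, ← h2]

/-- Each vertex passed by a loop can be joined back to q by one of finitely many chosen paths, which
gives quasiconvexity. -/
theorem loopSubgroup_fg [Finite α] [Finite G] (hE : IsSymmEdgeSet φ E) (q : G) :
    (loopSubgroup hE q).FG := by
  have hrep : ∀ q' : G, ∃ b : FreeGroup α, (∃ p : FreeGroup α, IsPath φ E q p.toWord ∧
      q * φ p = q') → IsPath φ E q b.toWord ∧ q * φ b = q' := by
    intro q'
    by_cases h : ∃ p : FreeGroup α, IsPath φ E q p.toWord ∧ q * φ p = q'
    · obtain ⟨p, hp⟩ := h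
      exact ⟨p, fun _ => hp⟩
    · exact ⟨1, fun h' => absurd h' h⟩
  choose b hb using hrep
  have := Fintype.ofFinite G
  refine IsQuasiconvex.fg (R := Finset.univ.sup fun q' => norm (b q')) ?_
  rintro δ ⟨hδ, -⟩ p hp
  obtain ⟨l, hl⟩ := hp.exists_toWord_eq_append
  rw [hl, isPath_append] at hδ
  obtain ⟨h1, h2⟩ := hb (q * φ p) ⟨p, hδ.1, rfl⟩
  refine ⟨b (q * φ p), Finset.le_sup (f := fun q' => norm (b q')) (Finset.mem_univ _), ?_, ?_⟩
  · refine hδ.1.toWord_mul ?_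
    have := h1.toWord_inv hE
    rwa [h2] at this
  · rw [_root_.map_mul, _root_.map_inv, mul_inv_eq_one]
    exact (mul_left_cancel h2).symm

end LoopSubgroup


/-- The subgroup is a loop group of a maximal t₀-convergent graph with one edge added. The
assumption L ≤ 2t₀ is the inequality (2d-1)e^(-2t₀) ≤ 1 behind the path bounds. -/
theorem exists_fg_of_half_log_le {α : Type*} [DecidableEq α] [Fintype α] [Nonempty α] {t₀ t : ℝ}
    (h0 : 0 < t₀) (ht : t₀ < t) (hlow : Real.log (2 * (Fintype.card α : ℝ) - 1) ≤ 2 * t₀)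
    (hhigh : t₀ ≤ Real.log (2 * (Fintype.card α : ℝ) - 1)) :
    ∃ H : Subgroup (FreeGroup α), H.FG ∧ poincare norm t₀ (H : Set (FreeGroup α)) = ∞ ∧
      poincare norm t (H : Set (FreeGroup α)) ≠ ∞ := by
  have hcard : 1 ≤ Fintype.card α := Fintype.card_pos
  have hcard' : (1 : ℝ) ≤ Fintype.card α := by exact_mod_cast hcard
  have hs : ((2 * Fintype.card α - 1 : ℕ) : ℝ≥0∞) * expWeight t₀ 2 ≤ 1 := by
    rw [expWeight, ← ENNReal.ofReal_natCast, ← ENNReal.ofReal_mul (by positivity),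
      ENNReal.ofReal_le_one]
    have e : ((2 * Fintype.card α - 1 : ℕ) : ℝ) = 2 * (Fintype.card α : ℝ) - 1 := by
      rw [Nat.cast_sub (by omega)]
      simp
    rw [e]
    have h2 : 2 * (Fintype.card α : ℝ) - 1 ≤ Real.exp (2 * t₀) := by
      rwa [← Real.log_le_iff_le_exp (by linarith)]
    have h3 : Real.exp (2 * t₀) * Real.exp (-t₀ * (2 : ℕ)) = 1 := by
      rw [← Real.exp_add]
      simp
      ring
    exact le_of_le_of_eq (by gcongr) h3
  -- This majorant depends only on d, t₀ and t, so the girth n can be fixed before the finite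
  -- quotient is chosen.
  let f : ℕ → ℝ≥0∞ := fun m =>
    ((4 * Fintype.card (α × Bool) ^ 2 * (m + 1) : ℕ) : ℝ≥0∞) * expWeight (t - t₀) m
  have hf : ∑' m, f m ≠ ∞ := tsum_natCast_mul_expWeight_ne_top (sub_pos.2 ht) _
  obtain ⟨n, hn⟩ := ((ENNReal.tendsto_sum_nat_add f hf).eventually
    (Iic_mem_nhds (show (0 : ℝ≥0∞) < 4⁻¹ by norm_num))).exists
  obtain ⟨ι, _, φ, hker⟩ := exists_finite_quotient (α := α) n
  let S : Set (Set (Equiv.Perm ι × (α × Bool))) := {E | IsSymmEdgeSet φ E ∧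
    ∀ q, poincare List.length t₀ (pathSet φ E q q) ≠ ∞}
  have hempty : ∅ ∈ S := by
    refine ⟨fun _ _ h => h.elim, fun q => poincare_ne_top_of_finite
      ((Set.finite_singleton []).subset ?_)⟩
    rintro (_ | ⟨x, w⟩) ⟨-, h, -⟩
    · rfl
    · exact h.1.elim
  obtain ⟨E, hES, hEmax⟩ := (Set.toFinite S).exists_maximal ⟨∅, hempty⟩
  obtain ⟨hE, hgood⟩ := hES
  -- With all edges present the loop group would be the kernel of φ, which is cobounded, and its
  -- series diverges at t₀ ≤ L.
  have huniv : E ≠ Set.univ := by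
    rintro rfl
    have h1 := hgood 1
    rw [← poincare_loopSubgroup hE] at h1
    have hrep : ∀ c : Equiv.Perm ι, ∃ b : FreeGroup α, (∃ p, φ p = c) → φ b = c := by
      intro c
      by_cases h : ∃ p, φ p = c
      · obtain ⟨p, hp⟩ := h
        exact ⟨p, fun _ => hp⟩
      · exact ⟨1, fun h' => absurd h' h⟩
    choose b hb using hrep
    have := Fintype.ofFinite (Equiv.Perm ι)
    refine poincare_univ_ne_top_of_cobounded h0 (H := loopSubgroup hE 1) (R := Finset.univ.sup fun c => norm (b c))
      (fun w => ⟨b (φ w), Finset.le_sup (f := fun c => norm (b c)) (Finset.mem_univ _), ?_, ?_⟩)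
      h1 (poincare_univ_eq_top hhigh)
    · have : ∀ (w : List (α × Bool)) (q : Equiv.Perm ι), IsPath φ Set.univ q w := by
        intro w
        induction w with
        | nil => exact fun _ => trivial
        | cons x w ih => exact fun q => ⟨trivial, ih _⟩
      exact this _ _
    · rw [_root_.map_mul, _root_.map_inv, hb (φ w) ⟨w, rfl⟩, mul_inv_cancel]
  obtain ⟨e, he⟩ := (Set.ne_univ_iff_exists_notMem E).1 huniv
  have hE' := hE.union_edge e
  have hbad : ∃ q, poincare List.length t₀ (pathSet φ (E ∪ {e, reverseEdge φ e}) q q) = ∞ := by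
    by_contra! h
    exact he (hEmax ⟨hE', h⟩ Set.subset_union_left (Or.inr (Or.inl rfl)))
  have hlen : ∀ q q' m, poincare List.length t {w | w ∈ pathSet φ E q q' ∧ w.length = m} ≤ f m := by
    intro q q' m
    have h1 := poincare_paths_le hE hs hgood q q' m
    refine le_trans (le_of_eq ?_) (mul_le_mul_left h1 (expWeight (t - t₀) m))
    rw [poincare, poincare, ← ENNReal.tsum_mul_right]
    refine tsum_congr fun w => ?_
    rw [w.2.2, mul_comm, ← expWeight_split]
  have hB : ∀ q q', poincare List.length t (pathSet φ E q q') ≤ ∑' m, f m := by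
    intro q q'
    rw [poincare_eq_tsum]
    exact ENNReal.tsum_le_tsum (hlen q q')
  have htail : ∀ q q', poincare List.length t {w | w ∈ pathSet φ E q q' ∧ n ≤ w.length} ≤ 4⁻¹ := by
    intro q q'
    have hsub : {w | w ∈ pathSet φ E q q' ∧ n ≤ w.length} ⊆
        ⋃ k : ℕ, {w | w ∈ pathSet φ E q q' ∧ w.length = k + n} := by
      rintro w ⟨hw, hwn⟩
      exact Set.mem_iUnion.2 ⟨w.length - n, hw, by omega⟩
    refine (poincare_mono hsub).trans ((poincare_iUnion_le _).trans (le_trans ?_ hn))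
    exact ENNReal.tsum_le_tsum fun k => hlen q q' (k + n)
  obtain ⟨q, hq⟩ := hbad
  refine ⟨loopSubgroup hE' q, loopSubgroup_fg hE' q, ?_, ?_⟩
  · rw [poincare_loopSubgroup, hq]
  · rw [poincare_loopSubgroup]
    exact poincare_union_edge_ne_top (h0.trans ht).le hker hf hB htail e q q

/-! ### Scaling exponents by raising generators to a power. -/

section PowerMap

variable {α : Type*} [DecidableEq α]

/-- The endomorphism of the free group raising each free generator to the power `k`. -/
def powMap (k : ℕ) : FreeGroup α →* FreeGroup α := lift fun a => of a ^ k

theorem powMap_mk (k : ℕ) (w : List (α × Bool)) :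
    powMap k (mk w) = mk (w.flatMap (List.replicate k)) := by
  induction w with
  | nil => rw [List.flatMap_nil, ← one_eq_mk, _root_.map_one]
  | cons x w ih =>
    rw [map_mk_cons, ih, List.flatMap_cons, ← mul_mk]
    congr 1
    rcases x with ⟨a, b⟩
    have h : mk (List.replicate k (a, true)) = of a ^ k := by
      rw [← toWord_of_pow, mk_toWord]
    cases b with
    | true =>
      rw [h]
      exact lift_apply_of
    | false =>
      have e0 : mk [(a, false)] = (of a)⁻¹ := rfl
      have e1 : mk (List.replicate k (a, false)) = (of a ^ k)⁻¹ := by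
        rw [← h, inv_mk]
        simp [invRev]
      rw [e0, e1, _root_.map_inv]
      congr 1
      exact lift_apply_of

theorem isReduced_flatMap_replicate {β : Type*} {k : ℕ} (hk : k ≠ 0) {w : List (β × Bool)}
    (hw : IsReduced w) : IsReduced (w.flatMap (List.replicate k)) := by
  have hrep : ∀ x : β × Bool, IsReduced (List.replicate k x) := fun x =>
    List.isChain_replicate_of_rel _ (by simp)
  induction w with
  | nil => exact IsReduced.nil
  | cons x w ih =>
    rw [List.flatMap_cons, isReduced_append_iff]
    refine ⟨hrep x, ih hw.tail, fun u hu v hv => ?_⟩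
    rw [List.eq_of_mem_replicate (List.mem_of_mem_getLast? hu)]
    cases w with
    | nil => simp at hv
    | cons y w =>
      obtain ⟨k, rfl⟩ := Nat.exists_eq_succ_of_ne_zero hk
      simp only [List.flatMap_cons, List.replicate_succ, List.cons_append, List.head?_cons,
        Option.mem_def, Option.some.injEq] at hv
      rw [← hv]
      exact (isReduced_cons_cons'.1 hw).1

theorem norm_powMap (k : ℕ) (x : FreeGroup α) : norm (powMap k x) = k * norm x := by
  rcases eq_or_ne k 0 with rfl | hk
  · have : powMap 0 x = 1 := by
      have h : x.toWord.flatMap (List.replicate 0) = [] := by simp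
      rw [← mk_toWord (x := x), powMap_mk, h, one_eq_mk]
    simp [this]
  · conv_lhs => rw [← mk_toWord (x := x), powMap_mk]
    rw [norm_mk_of_isReduced (isReduced_flatMap_replicate hk isReduced_toWord)]
    simp [List.length_flatMap, norm, mul_comm]

theorem poincare_map_powMap {k : ℕ} (hk : k ≠ 0) (s : ℝ) (H : Subgroup (FreeGroup α)) :
    poincare norm s (H.map (powMap k) : Set (FreeGroup α)) =
      poincare norm (k * s) (H : Set (FreeGroup α)) := by
  have hinj : Function.Injective (powMap k : FreeGroup α → FreeGroup α) := by
    rw [injective_iff_map_eq_one]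
    intro x hx
    have := norm_powMap k x
    rw [hx, norm_one, eq_comm, Nat.mul_eq_zero, norm_eq_zero] at this
    tauto
  rw [Subgroup.coe_map, poincare_image_of_injOn (len := fun x => k * norm x) hinj.injOn
    fun x _ => norm_powMap k x]
  refine tsum_congr fun x => ?_
  rw [expWeight, expWeight]
  congr 2
  push_cast
  ring

end PowerMap

/-- The exponents of convergence of finitely generated subgroups are dense. -/
theorem exists_fg_poincare {α : Type*} [DecidableEq α] [Fintype α] [Nonempty α] {t₀ t : ℝ}
    (h0 : 0 < t₀) (ht : t₀ < t) (htL : t ≤ Real.log (2 * (Fintype.card α : ℝ) - 1)) :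
    ∃ H : Subgroup (FreeGroup α), H.FG ∧ poincare norm t₀ (H : Set (FreeGroup α)) = ∞ ∧
      poincare norm t (H : Set (FreeGroup α)) ≠ ∞ := by
  set L := Real.log (2 * (Fintype.card α : ℝ) - 1) with hL
  have htpos : 0 < t := h0.trans ht
  -- This places kt in (L/2, L], since kt ≤ L < (k+1)t ≤ 2kt.
  set k := ⌊L / t⌋₊ with hk
  have hk1 : 1 ≤ k := Nat.le_floor (by rw [Nat.cast_one, one_le_div htpos]; exact htL)
  have hkL : k * t ≤ L := by
    have := Nat.floor_le (div_nonneg (htpos.le.trans htL) htpos.le)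
    rwa [le_div_iff₀ htpos] at this
  have hkL' : L < (k + 1) * t := by
    have := Nat.lt_floor_add_one (L / t)
    rwa [div_lt_iff₀ htpos] at this
  have hkpos : (1 : ℝ) ≤ k := by exact_mod_cast hk1
  have hlt : L / (2 * k) < t := by
    rw [div_lt_iff₀ (by positivity)]
    nlinarith
  -- Raising t₀ so that kt₁ ≥ L/2 is harmless: divergence at t₁ implies divergence at t₀.
  set t₁ := max t₀ (L / (2 * k)) with ht₁
  have h1 : t₁ < t := max_lt ht hlt
  have h2 : 0 < t₁ := lt_max_of_lt_left h0
  have h3 : L ≤ 2 * (k * t₁) := by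
    have : L / (2 * k) ≤ t₁ := le_max_right _ _
    rw [div_le_iff₀ (by positivity)] at this
    linarith
  obtain ⟨H, hH, hH0, hH1⟩ := exists_fg_of_half_log_le (α := α) (t₀ := k * t₁) (t := k * t)
    (by positivity) (by gcongr) h3 (by nlinarith)
  refine ⟨H.map (powMap k), ?_, ?_, ?_⟩
  · obtain ⟨S, rfl⟩ := hH
    exact ⟨S.image (powMap k), by rw [Finset.coe_image, MonoidHom.map_closure]⟩
  · rw [eq_top_iff, ← hH0, ← poincare_map_powMap (by omega)]
    exact poincare_anti_exponent (le_max_left _ _) _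
  · rwa [poincare_map_powMap (by omega)]

end FreeGroup

/-! ### From Poincaré series to critical exponents. -/

section CriticalExponent

open FreeGroup

variable {d : ℕ} {H : Subgroup (FreeGroup (Fin d))}

theorem summable_iff_poincare_ne_top {s : ℝ} :
    (Summable fun γ : H => Real.exp (-s * (norm (γ : FreeGroup (Fin d)) : ℝ))) ↔
      poincare norm s (H : Set (FreeGroup (Fin d))) ≠ ∞ := by
  constructor
  · intro h
    have := ENNReal.ofReal_tsum_of_nonneg (fun γ : H => (Real.exp_pos _).le) h
    have h2 : poincare norm s (H : Set (FreeGroup (Fin d))) =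
      ∑' γ : H, ENNReal.ofReal (Real.exp (-s * (norm (γ : FreeGroup (Fin d)) : ℝ))) := rfl
    rw [h2, ← this]
    exact ENNReal.ofReal_ne_top
  · intro h
    have := ENNReal.summable_toReal h
    refine this.congr fun γ => ?_
    exact ENNReal.toReal_ofReal (Real.exp_pos _).le

theorem criticalExponent_nonneg : 0 ≤ criticalExponent H :=
  Real.sInf_nonneg fun _ hs => hs.1.le

theorem criticalExponent_le {s : ℝ} (hs : 0 < s)
    (h : poincare norm s (H : Set (FreeGroup (Fin d))) ≠ ∞) : criticalExponent H ≤ s :=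
  csInf_le ⟨0, fun _ hs => hs.1.le⟩ ⟨hs, summable_iff_poincare_ne_top.2 h⟩

theorem criticalExponent_le_log (hd : 1 ≤ d) :
    criticalExponent H ≤ Real.log (2 * (d : ℝ) - 1) := by
  have hd' : (1 : ℝ) ≤ d := by exact_mod_cast hd
  have : Nonempty (Fin d) := ⟨⟨0, hd⟩⟩
  refine le_of_forall_gt_imp_ge_of_dense fun s hs => ?_
  refine criticalExponent_le ((Real.log_nonneg (by linarith)).trans_lt hs) ?_
  refine ne_top_of_le_ne_top (poincare_univ_ne_top (α := Fin d) ?_)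
    (poincare_mono (Set.subset_univ _))
  simpa using hs

theorem le_criticalExponent {s t : ℝ} (ht : 0 < t)
    (hs : poincare norm s (H : Set (FreeGroup (Fin d))) = ∞)
    (h : poincare norm t (H : Set (FreeGroup (Fin d))) ≠ ∞) : s ≤ criticalExponent H := by
  refine le_csInf ⟨t, ht, summable_iff_poincare_ne_top.2 h⟩ fun r hr => ?_
  by_contra! hlt
  apply summable_iff_poincare_ne_top.1 hr.2
  rw [eq_top_iff, ← hs]
  exact poincare_anti_exponent hlt.le _

theorem criticalExponent_bot : criticalExponent (⊥ : Subgroup (FreeGroup (Fin d))) = 0 := by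
  refine le_antisymm (le_of_forall_gt_imp_ge_of_dense fun s hs => ?_) criticalExponent_nonneg
  exact criticalExponent_le hs (poincare_ne_top_of_finite (Set.finite_singleton _))

end CriticalExponent

section Bot

variable {G : Type*} [Group G]

theorem conjSubgroup_bot (g : G) : conjSubgroup g (⊥ : Subgroup G) = ⊥ := Subgroup.map_bot _

theorem isBoomerang_bot : IsBoomerang (⊥ : Subgroup G) := by
  refine fun g => ⟨id, tendsto_id, ?_⟩
  simp only [conjSubgroup_bot]
  exact tendsto_const_nhds

theorem not_isConfined_bot : ¬ IsConfined (⊥ : Subgroup G) := by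
  rw [IsConfined, not_not]
  refine ⟨fun _ => 1, ?_⟩
  simp only [conjSubgroup_bot]
  exact tendsto_const_nhds

end Bot

end

theorem corollary1p4 (d : ℕ) (hd : 1 ≤ d) :
    {δ : ℝ | ∃ H : Subgroup (FreeGroup (Fin d)),
        IsBoomerang H ∧ ¬ IsConfined H ∧ criticalExponent H = δ} ⊆
      Set.Icc 0 (Real.log (2 * (d : ℝ) - 1)) ∧
    Set.Icc 0 (Real.log (2 * (d : ℝ) - 1)) ⊆
      closure {δ : ℝ | ∃ H : Subgroup (FreeGroup (Fin d)),
        IsBoomerang H ∧ ¬ IsConfined H ∧ criticalExponent H = δ} := by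
  constructor
  · rintro _ ⟨H, -, -, rfl⟩
    exact ⟨criticalExponent_nonneg, criticalExponent_le_log hd⟩
  -- For d = 1 the interval is {0}, attained by the trivial subgroup; the constructions need two
  -- generators.
  · rcases eq_or_lt_of_le hd with rfl | hd2
    · intro x hx
      have hx0 : x = 0 := by
        norm_num at hx
        exact hx
      exact subset_closure ⟨⊥, isBoomerang_bot, not_isConfined_bot, by
        rw [criticalExponent_bot, hx0]⟩
    · have : Nontrivial (Fin d) := Fin.nontrivial_iff_two_le.2 hd2
      have hd' : (2 : ℝ) ≤ d := by exact_mod_cast hd2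
      set L := Real.log (2 * (d : ℝ) - 1) with hL
      have hLpos : 0 < L := Real.log_pos (by linarith)
      have hIoo : Set.Ioo 0 L ⊆ closure {δ : ℝ | ∃ H : Subgroup (FreeGroup (Fin d)),
          IsBoomerang H ∧ ¬ IsConfined H ∧ criticalExponent H = δ} := by
        intro x hx
        rw [Metric.mem_closure_iff]
        intro ε hε
        -- The first term keeps t₀ positive, the second keeps it within ε of x; the critical
        -- exponent of K is then squeezed between t₀ and x.
        set t₀ := max (x / 2) (x - ε / 2) with ht₀
        have h0 : 0 < t₀ := lt_max_of_lt_left (by linarith [hx.1])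
        have h1 : t₀ < x := max_lt (by linarith [hx.1]) (by linarith)
        have hcard : Real.log (2 * (Fintype.card (Fin d) : ℝ) - 1) = L := by
          rw [Fintype.card_fin]
        obtain ⟨H, hH, hH0, hH1⟩ := FreeGroup.exists_fg_poincare (α := Fin d) h0 h1 (by
          rw [hcard]; exact hx.2.le)
        obtain ⟨K, hHK, hK1, hK2, hK3⟩ := FreeGroup.exists_boomerang_of_fg hH hx.1 (by
          rw [hcard]; exact hx.2.le) hH1
        refine ⟨_, ⟨K, hK1, hK2, rfl⟩, ?_⟩
        have hle := criticalExponent_le hx.1 hK3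
        have hge : t₀ ≤ criticalExponent K := le_criticalExponent hx.1 (by
          rw [eq_top_iff, ← hH0]
          exact poincare_mono hHK) hK3
        have : x - ε / 2 ≤ t₀ := le_max_right _ _
        rw [Real.dist_eq, abs_of_nonneg (by linarith)]
        linarith
      rw [← closure_Ioo hLpos.ne]
      exact closure_minimal hIoo isClosed_closure
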